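/- Let $\mathcal H$ be a real Hilbert space, $A$ a strictly positive self-adjoint (possibly unbounded) operator on $\mathcal H$, $Q$ a bounded operator on $\mathcal H$, and $w$ a standard cylindrical Wiener process on $\mathcal H$. For $\alpha\ge 0$ let $\mathcal H^\alpha=\mathcal D(A^\alpha)$ with norm $\|u\|_\alpha=\|(1+A)^\alpha u\|$, and let $\mathcal H^{-\alpha}\supseteq\mathcal H$ be the dual of $\mathcal H^\alpha$ under the pairing given by the inner product of $\mathcal H$. Let $v$ be a (weak) solution of the linear equation $dv=-Av\,dt+Q\,dw$. Let $\gamma\ge 0$ and $a\in[0,1)$ be such that almost surely $v$ has continuous sample paths with values in $\mathcal H^\gamma$. Let $F\colon\mathcal H^\gamma\to\mathcal H^{\gamma-a}$ and $F_\varepsilon\colon\mathcal H^\gamma\to\mathcal H^{\gamma-a}$ ($\varepsilon>0$) be locally Lipschitz, and assume that $F_\varepsilon\to F$ as $\varepsilon\to0$ locally uniformly, i.e. every point of $\mathcal H^\gamma$ has a neighbourhood on which $\|F_\varepsilon-F\|_{\gamma-a}\to 0$ uniformly. Given a realisation of the noise, a mild solution on $[0,T]$ of $du=-Au\,dt+F(u)\,dt+Q\,dw$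 with $u(0)=u_0\in\mathcal H^\gamma$ is a continuous $u\colon[0,T]\to\mathcal H^\gamma$ with \[ u(t)=e^{-tA}u_0+\int_0^t e^{-(t-s)A}F(u(s))\,ds+\bigl(v(t)-e^{-tA}v(0)\bigr),\qquad t\in[0,T], \] and mild solutions of $du_\varepsilon=-Au_\varepsilon\,dt+F_\varepsilon(u_\varepsilon)\,dt+Q\,dw$, $u_\varepsilon(0)=u_0^\varepsilon$, are defined in the same way. Then, almost surely, for all $u_0\in\mathcal H^\gamma$ and all $u_0^\varepsilon\in\mathcal H^\gamma$ with $u_0^\varepsilon\to u_0$ in $\mathcal H^\gamma$ as $\varepsilon\to 0$: the equation with $F$ and initial condition $u_0$ has a mild solution on $[0,T]$ for some $T>0$; and whenever $u$ is such a mild solution on an interval $[0,T]$, $T>0$, then for all sufficiently small $\varepsilon>0$ the equation with $F_\varepsilon$ and initial condition $u_0^\varepsilon$ has a mild solution on the same interval $[0,T]$, and all such solutions $u_\varepsilon$ satisfy $\sup_{t\in[0,T]}\|u_\varepsilon(t)-u(t)\|_\gamma\to0$ as $\varepsilon\to0$. -/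

import Mathlib

open MeasureTheory ProbabilityTheory Filter Topology Set
open scoped NNReal InnerProductSpace

set_option linter.unusedSectionVars false

noncomputable section

/-! ### The complexification of a real Hilbert space -/

/-- The complexification `H ⊕ iH` of a real Hilbert space `H`; the pair `(x, y)` stands for
`x + iy`, and `‖x + iy‖² = ‖x‖² + ‖y‖²`. -/
def Complexify (H : Type*) : Type _ := WithLp 2 (H × H)

namespace Complexify

variable {H : Type*} [NormedAddCommGroup H] [InnerProductSpace ℝ H]

instance : NormedAddCommGroup (Complexify H) :=
  inferInstanceAs (NormedAddCommGroup (WithLp 2 (H × H)))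

instance [CompleteSpace H] : CompleteSpace (Complexify H) :=
  inferInstanceAs (CompleteSpace (WithLp 2 (H × H)))

/-- The vector `x + iy`. -/
def mk (x y : H) : Complexify H := WithLp.toLp 2 (x, y)

/-- The real part of a vector. -/
def re (z : Complexify H) : H := (WithLp.ofLp z).1

/-- The imaginary part of a vector. -/
def im (z : Complexify H) : H := (WithLp.ofLp z).2

@[simp] lemma re_mk (x y : H) : (mk x y).re = x := rfl

@[simp] lemma im_mk (x y : H) : (mk x y).im = y := rfl

@[simp] lemma re_add (z w : Complexify H) : (z + w).re = z.re + w.re := rfl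

@[simp] lemma im_add (z w : Complexify H) : (z + w).im = z.im + w.im := rfl

@[simp] lemma re_zero : (0 : Complexify H).re = 0 := rfl

@[simp] lemma im_zero : (0 : Complexify H).im = 0 := rfl

lemma ext' {z w : Complexify H} (h₁ : z.re = w.re) (h₂ : z.im = w.im) : z = w :=
  WithLp.ofLp_injective 2 (Prod.ext h₁ h₂)

lemma norm_sq (z : Complexify H) : ‖z‖ ^ 2 = ‖z.re‖ ^ 2 + ‖z.im‖ ^ 2 :=
  WithLp.prod_norm_sq_eq_of_L2 (α := H) (β := H) z

instance : SMul ℂ (Complexify H) :=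
  ⟨fun c z => mk (c.re • z.re - c.im • z.im) (c.im • z.re + c.re • z.im)⟩

@[simp] lemma re_smul (c : ℂ) (z : Complexify H) :
    (c • z).re = c.re • z.re - c.im • z.im := rfl

@[simp] lemma im_smul (c : ℂ) (z : Complexify H) :
    (c • z).im = c.im • z.re + c.re • z.im := rfl

instance : Module ℂ (Complexify H) where
  one_smul z := ext' (by simp) (by simp)
  mul_smul c d z := ext' (by simp; module) (by simp; module)
  smul_zero c := ext' (by simp) (by simp)
  smul_add c z w := ext' (by simp; module) (by simp; module)
  add_smul c d z := ext' (by simp; module) (by simp; module)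
  zero_smul z := ext' (by simp) (by simp)

/-- `⟨x + iy, x' + iy'⟩ = ⟨x, x'⟩ + ⟨y, y'⟩ + i (⟨x, y'⟩ - ⟨y, x'⟩)`. -/
instance : Inner ℂ (Complexify H) :=
  ⟨fun z w => ⟨⟪z.re, w.re⟫_ℝ + ⟪z.im, w.im⟫_ℝ, ⟪z.re, w.im⟫_ℝ - ⟪z.im, w.re⟫_ℝ⟩⟩

@[simp] lemma inner_re (z w : Complexify H) :
    (inner ℂ z w).re = ⟪z.re, w.re⟫_ℝ + ⟪z.im, w.im⟫_ℝ := rfl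

@[simp] lemma inner_im (z w : Complexify H) :
    (inner ℂ z w).im = ⟪z.re, w.im⟫_ℝ - ⟪z.im, w.re⟫_ℝ := rfl

lemma norm_smul' (c : ℂ) (z : Complexify H) : ‖c • z‖ = ‖c‖ * ‖z‖ := by
  refine (sq_eq_sq₀ (norm_nonneg _) (by positivity)).1 ?_
  rw [mul_pow, norm_sq, norm_sq, Complex.sq_norm, Complex.normSq_apply, re_smul, im_smul,
    norm_sub_sq_real, norm_add_sq_real]
  simp only [norm_smul, mul_pow, real_inner_smul_left, real_inner_smul_right,
    Real.norm_eq_abs, sq_abs]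
  ring

instance : InnerProductSpace ℂ (Complexify H) where
  norm_smul_le c z := (norm_smul' c z).le
  norm_sq_eq_re_inner z := by
    rw [norm_sq, RCLike.re_eq_complex_re, inner_re, real_inner_self_eq_norm_sq,
      real_inner_self_eq_norm_sq]
  conj_inner_symm z w := by
    apply Complex.ext
    · simp [real_inner_comm]
    · simp only [Complex.conj_im, inner_im]
      rw [real_inner_comm z.re, real_inner_comm z.im]; ring
  add_left z w u := by
    apply Complex.ext
    · simp [inner_add_left]; ring
    · simp [inner_add_left]; ring
  smul_left z w c := by
    apply Complex.ext
    · simp [inner_add_left, inner_sub_left, real_inner_smul_left]; try ring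
    · simp [inner_add_left, inner_sub_left, real_inner_smul_left]; try ring

lemma norm_re_le (z : Complexify H) : ‖z.re‖ ≤ ‖z‖ := by
  refine (sq_le_sq₀ (norm_nonneg _) (norm_nonneg _)).1 ?_
  rw [norm_sq]; nlinarith [sq_nonneg ‖z.im‖]

/-- The complex-linear extension `x + iy ↦ T x + i T y` of a real operator. -/
def map (T : H →L[ℝ] H) : Complexify H →L[ℂ] Complexify H :=
  LinearMap.mkContinuous
    { toFun := fun z => mk (T z.re) (T z.im)
      map_add' := fun z w => ext' (by simp) (by simp)
      map_smul' := fun c z => ext' (by simp) (by simp) }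
    ‖T‖ (fun z => by
      refine (sq_le_sq₀ (norm_nonneg _) (by positivity)).1 ?_
      rw [mul_pow, norm_sq, norm_sq]
      have h1 := pow_le_pow_left₀ (norm_nonneg _) (T.le_opNorm z.re) 2
      have h2 := pow_le_pow_left₀ (norm_nonneg _) (T.le_opNorm z.im) 2
      rw [mul_pow] at h1 h2
      simp only [LinearMap.coe_mk, AddHom.coe_mk, re_mk, im_mk]
      nlinarith)

/-- The compression `x ↦ Re (T x)` of a complex operator to the real subspace `H`. -/
def compress (T : Complexify H →L[ℂ] Complexify H) : H →L[ℝ] H :=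
  LinearMap.mkContinuous
    { toFun := fun x => (T (mk x 0)).re
      map_add' := fun x y => by
        rw [← re_add, ← map_add]
        congr 2
        exact ext' (by simp) (by simp)
      map_smul' := fun c x => by
        have : mk (c • x) 0 = (c : ℂ) • mk x 0 := ext'
          (by rw [re_smul, re_mk, re_mk, im_mk, Complex.ofReal_re, Complex.ofReal_im]; simp)
          (by rw [im_smul, im_mk, re_mk, im_mk, Complex.ofReal_re, Complex.ofReal_im]; simp)
        rw [this, map_smul, re_smul, Complex.ofReal_re, Complex.ofReal_im]
        simp }
    ‖T‖ (fun x => by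
      refine (norm_re_le _).trans ((T.le_opNorm _).trans (le_of_eq ?_))
      congr 1
      refine (sq_eq_sq₀ (norm_nonneg _) (norm_nonneg _)).1 ?_
      rw [norm_sq]; simp)

end Complexify

/-! ### Strictly positive self-adjoint operators and their functional calculus -/

/-- A strictly positive self-adjoint (in general unbounded) operator on a real Hilbert space. -/
structure PosSelfAdjoint (H : Type*) [NormedAddCommGroup H] [InnerProductSpace ℝ H]
    [CompleteSpace H] where
  /-- The operator, with its domain. -/
  op : H →ₗ.[ℝ] H
  isSelfAdjoint : IsSelfAdjoint op
  pos : ∀ x : op.domain, x ≠ 0 → 0 < ⟪op x, (x : H)⟫_ℝ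

namespace PosSelfAdjoint

variable {H : Type*} [NormedAddCommGroup H] [InnerProductSpace ℝ H] [CompleteSpace H]
variable (A : PosSelfAdjoint H)

lemma nonneg (x : A.op.domain) : 0 ≤ ⟪A.op x, (x : H)⟫_ℝ := by
  rcases eq_or_ne x 0 with rfl | h
  · simp
  · exact (A.pos x h).le

lemma norm_le (x : A.op.domain) : ‖(x : H)‖ ≤ ‖(x : H) + A.op x‖ := by
  rcases eq_or_ne ‖(x : H)‖ 0 with h | h
  · rw [h]; positivity
  · have h0 : 0 < ‖(x : H)‖ := lt_of_le_of_ne (norm_nonneg _) (Ne.symm h)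
    have h1 : ‖(x : H)‖ * ‖(x : H)‖ ≤ ‖(x : H) + A.op x‖ * ‖(x : H)‖ := by
      refine le_trans ?_ (real_inner_le_norm _ _)
      rw [inner_add_left, real_inner_self_eq_norm_mul_norm]
      linarith [A.nonneg x]
    exact le_of_mul_le_mul_right h1 h0

/-- The linear map `1 + A` on the domain of `A`. -/
def oneAdd : A.op.domain →ₗ[ℝ] H := A.op.domain.subtype + A.op.toFun

lemma oneAdd_apply (x : A.op.domain) : A.oneAdd x = (x : H) + A.op x := rfl

lemma oneAdd_injective : Function.Injective A.oneAdd := by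
  rw [← LinearMap.ker_eq_bot, LinearMap.ker_eq_bot']
  intro x hx
  have := A.norm_le x
  rw [← oneAdd_apply, hx, norm_zero] at this
  exact Subtype.ext (norm_le_zero_iff.1 this)

lemma oneAdd_surjective : Function.Surjective A.oneAdd := by
  have hdense : Dense (A.op.domain : Set H) := A.isSelfAdjoint.dense_domain
  have hadj : A.op.adjoint = A.op := LinearPMap.isSelfAdjoint_def.1 A.isSelfAdjoint
  have hclosed : IsClosed (LinearMap.range A.oneAdd : Set H) := by
    refine isClosed_of_closure_subset fun y hy => ?_
    obtain ⟨f, hf, hlim⟩ := mem_closure_iff_seq_limit.1 hy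
    choose x hx using hf
    have hc : CauchySeq (fun n => (x n : H)) := by
      refine Metric.cauchySeq_iff.2 fun e he => ?_
      obtain ⟨N, hN⟩ := Metric.cauchySeq_iff.1 hlim.cauchySeq e he
      refine ⟨N, fun m hm n hn => lt_of_le_of_lt ?_ (hN m hm n hn)⟩
      rw [dist_eq_norm, dist_eq_norm, ← hx, ← hx, ← map_sub, oneAdd_apply]
      exact A.norm_le (x m - x n)
    obtain ⟨z, hz⟩ := cauchySeq_tendsto_of_complete hc
    have hA : Tendsto (fun n => A.op (x n)) atTop (𝓝 (y - z)) := by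
      have : (fun n => A.op (x n)) = fun n => f n - (x n : H) := by
        funext n; rw [← hx, oneAdd_apply]; abel
      rw [this]; exact hlim.sub hz
    have hmem : (z, y - z) ∈ A.op.graph := by
      have hcl : IsClosed (A.op.graph : Set (H × H)) := A.isSelfAdjoint.isClosed
      exact hcl.mem_of_tendsto (hz.prodMk_nhds hA)
        (Eventually.of_forall fun n => A.op.mem_graph (x n))
    obtain ⟨w, hw1, hw2⟩ := (LinearPMap.mem_graph_iff _).1 hmem
    refine ⟨w, ?_⟩
    rw [oneAdd_apply, hw2]
    simp only at hw1
    rw [hw1, add_sub_cancel]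
  have hbot : (LinearMap.range A.oneAdd)ᗮ = ⊥ := by
    rw [Submodule.eq_bot_iff]
    intro y hy
    have hy' : ∀ x : A.op.domain, ⟪-y, (x : H)⟫_ℝ = ⟪y, A.op x⟫_ℝ := by
      intro x
      have := (Submodule.mem_orthogonal' _ _).1 hy (A.oneAdd x) ⟨x, rfl⟩
      rw [oneAdd_apply, inner_add_right] at this
      rw [inner_neg_left]; linarith
    have hmem : y ∈ A.op.adjoint.domain :=
      LinearPMap.mem_adjoint_domain_of_exists y ⟨-y, hy'⟩
    have hval : A.op.adjoint ⟨y, hmem⟩ = -y :=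
      LinearPMap.adjoint_apply_eq hdense ⟨y, hmem⟩ hy'
    have hgraph : (y, -y) ∈ A.op.graph := by
      rw [← hadj]
      exact (LinearPMap.mem_graph_iff _).2 ⟨⟨y, hmem⟩, rfl, hval⟩
    obtain ⟨w, hw1, hw2⟩ := (LinearPMap.mem_graph_iff _).1 hgraph
    simp only at hw1 hw2
    have := A.nonneg w
    rw [hw2, hw1, inner_neg_left, real_inner_self_eq_norm_sq] at this
    have h0 : ‖y‖ ^ 2 = 0 := le_antisymm (by linarith) (sq_nonneg _)
    simpa using h0
  have htop : LinearMap.range A.oneAdd = ⊤ := by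
    have := hclosed.submodule_topologicalClosure_eq
    rw [← this, ← Submodule.orthogonal_orthogonal_eq_closure, hbot, Submodule.bot_orthogonal_eq_top]
  exact LinearMap.range_eq_top.1 htop

/-- The bijection `1 + A : D(A) → H`. -/
def oneAddEquiv : A.op.domain ≃ₗ[ℝ] H :=
  LinearEquiv.ofBijective A.oneAdd ⟨A.oneAdd_injective, A.oneAdd_surjective⟩

/-- The bounded operator `(1 + A)⁻¹` on `H`. -/
def resolvent : H →L[ℝ] H :=
  LinearMap.mkContinuous (A.op.domain.subtype ∘ₗ A.oneAddEquiv.symm.toLinearMap) 1 (fun y => by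
    have h := A.norm_le (A.oneAddEquiv.symm y)
    have h2 : A.oneAdd (A.oneAddEquiv.symm y) = y := A.oneAddEquiv.apply_symm_apply y
    rw [← oneAdd_apply, h2] at h
    simpa using h)

lemma resolvent_mem (y : H) : A.resolvent y ∈ A.op.domain := (A.oneAddEquiv.symm y).2

lemma resolvent_spec (y : H) :
    A.resolvent y + A.op ⟨A.resolvent y, A.resolvent_mem y⟩ = y :=
  A.oneAddEquiv.apply_symm_apply y

lemma resolvent_symm (x y : H) : ⟪A.resolvent x, y⟫_ℝ = ⟪x, A.resolvent y⟫_ℝ := by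
  have hf : A.op.IsFormalAdjoint A.op := by
    have := LinearPMap.adjoint_isFormalAdjoint (T := A.op) A.isSelfAdjoint.dense_domain
    rwa [LinearPMap.isSelfAdjoint_def.1 A.isSelfAdjoint] at this
  have h := hf ⟨A.resolvent x, A.resolvent_mem x⟩ ⟨A.resolvent y, A.resolvent_mem y⟩
  conv_lhs => rw [← A.resolvent_spec y]
  conv_rhs => rw [← A.resolvent_spec x]
  rw [inner_add_left, inner_add_right]
  simp only at h
  rw [h]

lemma resolvent_nonneg (x : H) : 0 ≤ ⟪A.resolvent x, x⟫_ℝ := by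
  have key : ∀ y z : H, 0 ≤ ⟪z, y⟫_ℝ → 0 ≤ ⟪y, y + z⟫_ℝ := fun y z h => by
    rw [inner_add_right]
    have := real_inner_self_nonneg (x := y)
    rw [real_inner_comm] at h
    linarith
  have := key _ _ (A.nonneg ⟨A.resolvent x, A.resolvent_mem x⟩)
  simp only at this
  rwa [A.resolvent_spec x] at this

lemma map_resolvent_nonneg : 0 ≤ Complexify.map A.resolvent := by
  rw [ContinuousLinearMap.nonneg_iff_isPositive, ContinuousLinearMap.isPositive_iff_complex]
  intro z
  have h1 : (inner ℂ (Complexify.map A.resolvent z) z).im = 0 := by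
    change ⟪A.resolvent z.re, z.im⟫_ℝ - ⟪A.resolvent z.im, z.re⟫_ℝ = 0
    rw [A.resolvent_symm, real_inner_comm, sub_self]
  have h2 : 0 ≤ (inner ℂ (Complexify.map A.resolvent z) z).re :=
    add_nonneg (A.resolvent_nonneg z.re) (A.resolvent_nonneg z.im)
  refine ⟨Complex.ext (by simp) (by simp [h1]), h2⟩

/-- The operator `f(A)`, for `f : [0, ∞) → ℝ` continuous with a finite limit at `∞`. It is obtained
from the continuous functional calculus of the bounded self-adjoint operator `R = (1 + A)⁻¹`, with
spectrum in `[0, 1]`: `f(A) = g(R)` where `g(r) = f(1/r - 1)` for `r > 0` and `g(0) = f(∞)`. The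
calculus is applied to the complexification of `R`, and its value restricted to the real space. -/
def fc (f : ℝ → ℝ) : H →L[ℝ] H :=
  Complexify.compress
    (cfc (fun r : ℝ => if 0 < r then f (1 / r - 1) else limUnder atTop f)
      (Complexify.map A.resolvent))

/-- Consistency: `f(A) = 1` for `f = 1`. -/
lemma fc_one : A.fc (fun _ => 1) = ContinuousLinearMap.id ℝ H := by
  have h1 : (fun r : ℝ => if 0 < r then (1 : ℝ) else limUnder atTop (fun _ : ℝ => (1 : ℝ)))
      = fun _ => 1 := by
    funext r; rw [tendsto_const_nhds.limUnder_eq]; simp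
  have hsa : IsSelfAdjoint (Complexify.map A.resolvent) := .of_nonneg A.map_resolvent_nonneg
  ext x
  simp only [fc, h1]
  rw [cfc_const_one ℝ (Complexify.map A.resolvent) hsa]
  rfl

/-- Consistency: `f(A) = (1 + A)⁻¹` for `f(l) = (1 + l)⁻¹`. -/
lemma fc_inv : A.fc (fun l => (1 + l) ^ (-1 : ℝ)) = A.resolvent := by
  have hn := A.map_resolvent_nonneg
  have hl : Tendsto (fun l : ℝ => (1 + l) ^ (-1 : ℝ)) atTop (𝓝 0) :=
    (tendsto_rpow_neg_atTop one_pos).comp (tendsto_atTop_add_const_left _ _ tendsto_id)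
  have : cfc (fun r : ℝ => if 0 < r then (1 + (1 / r - 1)) ^ (-1 : ℝ) else
      limUnder atTop (fun l : ℝ => (1 + l) ^ (-1 : ℝ))) (Complexify.map A.resolvent) =
      Complexify.map A.resolvent := by
    conv_rhs => rw [← cfc_id ℝ (Complexify.map A.resolvent) (.of_nonneg hn)]
    refine cfc_congr fun r hr => ?_
    have h0 : 0 ≤ r := spectrum_nonneg_of_nonneg hn hr
    rw [hl.limUnder_eq]
    rcases h0.eq_or_lt with rfl | h
    · simp
    · simp [h, Real.rpow_neg_one]
  ext x
  simp only [fc, this]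
  rfl
/-! ### The scale of spaces -/

/-- The Hilbert space `H^α`, `α ∈ ℝ`: the domain `D(A^α) = D((1 + A)^α)` for `α ≥ 0`, and the dual
of `H^(-α)` (a superspace of `H`) for `α < 0`; with the norm `‖u‖_α = ‖(1 + A)^α u‖`, which is
equivalent to `‖A^α u‖` when the spectrum of `A` is bounded away from `0`. Since `(1 + A)^α` is an
isometry of `H^α` onto `H`, the element `u` of `H^α` is recorded as the vector `(1 + A)^α u` of `H`;
`toBase` below gives the inclusion in `H` and `dualEquiv` the duality. -/
def Hs (_A : PosSelfAdjoint H) (_α : ℝ) : Type _ := H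

instance (α : ℝ) : NormedAddCommGroup (A.Hs α) := inferInstanceAs (NormedAddCommGroup H)

instance (α : ℝ) : InnerProductSpace ℝ (A.Hs α) := inferInstanceAs (InnerProductSpace ℝ H)

instance (α : ℝ) : CompleteSpace (A.Hs α) := inferInstanceAs (CompleteSpace H)

/-- The isometry `(1 + A)^α : H^α → H`. -/
def lift (α : ℝ) : A.Hs α ≃ₗᵢ[ℝ] H := LinearIsometryEquiv.refl ℝ H

/-- The inclusion `H^α ⊆ H`, for `α ≥ 0`: the element `u` of `H^α` recorded by `c = (1 + A)^α u` is
the vector `(1 + A)^(-α) c` of `H`. -/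
def toBase (α : ℝ) : A.Hs α →L[ℝ] H :=
  (A.fc (fun l => (1 + l) ^ (-α))) ∘L (A.lift α : A.Hs α →L[ℝ] H)

/-- The duality between `H^(-α)` and `H^α` given by the inner product of `H`:
`⟨φ, u⟩ = ⟨(1 + A)^(-α) φ, (1 + A)^α u⟩`. It identifies `H^(-α)` with the dual space of `H^α`. -/
def dualEquiv (α : ℝ) : A.Hs (-α) ≃ₗᵢ[ℝ] StrongDual ℝ (A.Hs α) :=
  ((A.lift (-α)).trans (A.lift α).symm).trans (InnerProductSpace.toDual ℝ (A.Hs α))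

/-- For `α = 1` the subspace `H^α` of `H` is the domain of `A`. -/
lemma range_toBase_one : range (A.toBase 1) = (A.op.domain : Set H) := by
  ext x
  constructor
  · rintro ⟨c, rfl⟩
    rw [toBase, fc_inv]
    exact A.resolvent_mem (A.lift 1 c)
  · intro hx
    refine ⟨(A.lift 1).symm (A.oneAdd ⟨x, hx⟩), ?_⟩
    rw [toBase, fc_inv]
    exact congrArg Subtype.val (A.oneAddEquiv.symm_apply_apply ⟨x, hx⟩)

/-- The operator `e^(-tA) : H^β → H^α`, for `t > 0` and all real `α, β`, as well as for `t = 0` and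
`α ≤ β`. In terms of the recording vectors, `(1 + A)^α e^(-tA) φ` is the image of `(1 + A)^β φ`
under `(1 + A)^(α - β) e^(-tA)`. -/
def semigroup (β α t : ℝ) : A.Hs β →L[ℝ] A.Hs α :=
  ((A.lift α).symm : H →L[ℝ] A.Hs α) ∘L
    (A.fc (fun l => (1 + l) ^ (α - β) * Real.exp (-(t * l)))) ∘L
      (A.lift β : A.Hs β →L[ℝ] H)

/-- `u : [0, T] → H^γ` is a mild solution, for one realisation of the noise, of
`du = -A u dt + F(u) dt + Q dw`, `u(0) = u₀`:
`u(t) = e^(-tA) u₀ + ∫₀ᵗ e^(-(t-s)A) F(u(s)) ds + (v(t) - e^(-tA) v(0))`,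
where `v` is the path of a solution of the linear equation `dv = -A v dt + Q dw` (so that
`v(t) - e^(-tA) v(0)` is the stochastic convolution `∫₀ᵗ e^(-(t-s)A) Q dw(s)`). -/
structure IsMildSolution {γ β : ℝ} (F : A.Hs γ → A.Hs β) (v : ℝ → A.Hs γ) (u₀ : A.Hs γ) (T : ℝ)
    (u : ℝ → A.Hs γ) : Prop where
  continuousOn : ContinuousOn u (Icc 0 T)
  integrable : ∀ t ∈ Icc 0 T,
    IntervalIntegrable (fun s => A.semigroup β γ (t - s) (F (u s))) volume 0 t
  eq : ∀ t ∈ Icc 0 T,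
    u t = A.semigroup γ γ t u₀ + (∫ s in (0 : ℝ)..t, A.semigroup β γ (t - s) (F (u s)))
      + (v t - A.semigroup γ γ t (v 0))

end PosSelfAdjoint

/-! ### The noise and the linear equation -/

/-- `W` is a standard cylindrical Wiener process on `H` (`W t h` plays the role of `⟨w(t), h⟩`): a
centred Gaussian family with covariance `min(s, t) ⟨h, k⟩` and continuous paths `t ↦ W t h`. -/
structure IsCylindricalWiener {H Ω : Type*} [NormedAddCommGroup H] [InnerProductSpace ℝ H]
    [MeasurableSpace Ω] (W : ℝ≥0 → H → Ω → ℝ) (μ : Measure Ω) : Prop where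
  gaussian : IsGaussianProcess (fun p : ℝ≥0 × H => W p.1 p.2) μ
  mean : ∀ t h, ∫ ω, W t h ω ∂μ = 0
  cov : ∀ s t h k, ∫ ω, W s h ω * W t k ω ∂μ = (min s t : ℝ≥0) * ⟪h, k⟫_ℝ
  continuous : ∀ h, ∀ᵐ ω ∂μ, Continuous fun t => W t h ω

/-- `v` is a (weak) solution of the linear equation `dv = -A v dt + Q dw`: an `H`-valued process
with almost surely continuous paths such that, for all `h ∈ D(A)` and `t ≥ 0`, almost surely
`⟨v(t), h⟩ = ⟨v(0), h⟩ - ∫₀ᵗ ⟨v(s), A h⟩ ds + ⟨w(t), Q* h⟩`. -/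
structure IsLinearSolution {H Ω : Type*} [NormedAddCommGroup H] [InnerProductSpace ℝ H]
    [CompleteSpace H] [MeasurableSpace Ω] (A : PosSelfAdjoint H) (Q : H →L[ℝ] H)
    (W : ℝ≥0 → H → Ω → ℝ) (μ : Measure Ω) (v : ℝ → Ω → H) : Prop where
  measurable : ∀ t, 0 ≤ t → AEStronglyMeasurable (v t) μ
  continuous : ∀ᵐ ω ∂μ, ContinuousOn (fun t => v t ω) (Ici 0)
  eq : ∀ (t : ℝ≥0) (h : A.op.domain), ∀ᵐ ω ∂μ,
    ⟪v t ω, (h : H)⟫_ℝ = ⟪v 0 ω, (h : H)⟫_ℝ - (∫ s in (0 : ℝ)..t, ⟪v s ω, A.op h⟫_ℝ)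
      + W t (ContinuousLinearMap.adjoint Q (h : H)) ω

end

/-!
Almost surely `v` has continuous paths in `H^γ`. For such a realisation the mild equation is a
deterministic Volterra equation `u(t) = g(t) + ∫₀ᵗ K(t - s) F(u(s)) ds` with the continuous forcing
`g(t) = e^(-tA) u₀ + (v(t) - e^(-tA) v(0))` and the kernel `K(t) = e^(-tA) : H^(γ - a) → H^γ`
(`PosSelfAdjoint.isMildSolution_iff`). The functional calculus gives the bound
`‖K(t)‖ ≤ e^T t ^ (-a)` on `(0, T]`, which is integrable since `a < 1`, together with the
norm-continuity of `K` on `(0, ∞)` (`PosSelfAdjoint.isSingularKernel_semigroup`) and the strong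
continuity of the semigroup on `H^γ`, hence the continuity of `g`.

The rest is a theory of Volterra equations with such a kernel.

* `IsVolterraSolution.stability`: in a norm with weight `e^(-ct)`, `c` large, convolution with `K`
  is as small as desired, so a perturbation of `F` and `g` of size `η` moves a solution by at most
  `M η`. The perturbed equation needs a Lipschitz bound only on the limiting `F`: the maps `F_ε` are
  locally Lipschitz, but with constants that may blow up as `ε → 0`. A first-exit argument keeps the
  perturbed solution in the tube around `u` on which `F` is Lipschitz and `F_ε` is close to `F`.
  Uniqueness is the case of no perturbation.
* `IsVolterraSolution.exists_extension`: a contraction argument extends a solution beyond its final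
  time; starting from the trivial interval `[0, 0]` this is local existence.
* `exists_isVolterraSolution_of_bounded`: a bound on `F(w)` along all solutions rules out blow-up.
  For `F_ε` the bound comes from the stability estimate, which puts `w` in the tube around `u`.

`IsVolterraSolution.continuous_dependence` combines these.
-/

/-! ### Convolution with a weakly singular kernel -/

section Volterra

variable {X Y : Type*} [NormedAddCommGroup X] [NormedSpace ℝ X] [NormedAddCommGroup Y]
  [NormedSpace ℝ Y]

/-- `K` is an operator-valued kernel on `(0, T]` with an integrable singularity at `0`: it is
continuous in operator norm on `(0, ∞)` and `‖K t‖ ≤ C t ^ (-a)` with `0 ≤ a < 1`. The value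
`K 0` is irrelevant. -/
structure IsSingularKernel (K : ℝ → Y →L[ℝ] X) (C a T : ℝ) : Prop where
  continuousOn : ContinuousOn K (Ioi 0)
  nonneg : 0 ≤ C
  exponent_nonneg : 0 ≤ a
  exponent_lt_one : a < 1
  norm_le : ∀ t ∈ Ioc 0 T, ‖K t‖ ≤ C * t ^ (-a)

/-- The convolution `(K * h)(t) = ∫₀ᵗ K(t - s) h(s) ds`. -/
noncomputable def volterraConv (K : ℝ → Y →L[ℝ] X) (h : ℝ → Y) (t : ℝ) : X :=
  ∫ s in (0 : ℝ)..t, K (t - s) (h s)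

lemma intervalIntegrable_sub_rpow_neg {a : ℝ} (ha : a < 1) (t b c : ℝ) :
    IntervalIntegrable (fun s : ℝ => (t - s) ^ (-a)) volume b c := by
  have h := (intervalIntegral.intervalIntegrable_rpow' (a := t - b) (b := t - c)
    (r := -a) (by linarith)).comp_sub_left t
  simpa using h

lemma integral_sub_rpow_neg {a : ℝ} (ha : a < 1) (t₁ t : ℝ) :
    ∫ s in t₁..t, (t - s) ^ (-a) = (t - t₁) ^ (1 - a) / (1 - a) := by
  rw [intervalIntegral.integral_comp_sub_left (fun x => x ^ (-a)) t,
    integral_rpow (Or.inl (by linarith)), sub_self, Real.zero_rpow (by linarith)]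
  rw [show -a + 1 = 1 - a by ring]; ring

/-- For a large rate `c`, the exponential weight `exp (c t)` makes the convolution with `t ^ (-a)`
as small as desired, uniformly in `t`. This replaces a singular Gronwall inequality. -/
lemma exists_exp_weight {a B : ℝ} (ha : a < 1) (hB : 0 < B) :
    ∃ c : ℝ, 0 ≤ c ∧ ∀ t : ℝ, 0 ≤ t →
      ∫ s in (0 : ℝ)..t, (t - s) ^ (-a) * Real.exp (c * s) ≤ B * Real.exp (c * t) := by
  have hlim : Tendsto (fun c : ℝ => (1 / c) ^ (1 - a) * Real.Gamma (1 - a)) atTop (𝓝 0) := by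
    have h1 : Tendsto (fun c : ℝ => (1 / c) ^ (1 - a)) atTop (𝓝 0) := by
      have := (tendsto_const_nhds.div_atTop tendsto_id :
        Tendsto (fun c : ℝ => 1 / c) atTop (𝓝 0)).rpow_const (p := 1 - a) (Or.inr (by linarith))
      rwa [Real.zero_rpow (by linarith)] at this
    simpa using h1.mul_const (Real.Gamma (1 - a))
  obtain ⟨c, hc, hc0⟩ := ((hlim.eventually_lt_const hB).and (eventually_gt_atTop 0)).exists
  refine ⟨c, hc0.le, fun t ht => ?_⟩
  have hint : IntegrableOn (fun r : ℝ => r ^ (-a) * Real.exp (-(c * r))) (Ioi 0) := by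
    have := integrableOn_rpow_mul_exp_neg_mul_rpow (p := 1) (s := -a) (b := c) (by linarith)
      one_pos hc0
    simpa using this
  have heq : ∫ s in (0 : ℝ)..t, (t - s) ^ (-a) * Real.exp (c * s)
      = Real.exp (c * t) * ∫ r in (0 : ℝ)..t, r ^ (-a) * Real.exp (-(c * r)) := by
    rw [← intervalIntegral.integral_const_mul]
    have h2 := intervalIntegral.integral_comp_sub_left (a := 0) (b := t)
      (fun r => Real.exp (c * t) * (r ^ (-a) * Real.exp (-(c * r)))) t
    rw [sub_self, sub_zero] at h2
    rw [← h2]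
    congr 1; funext s
    rw [mul_left_comm, ← Real.exp_add]; congr 2; ring
  rw [heq, mul_comm]
  gcongr
  rw [intervalIntegral.integral_of_le ht]
  refine (setIntegral_mono_set hint ?_ Ioc_subset_Ioi_self.eventuallyLE).trans ?_
  · filter_upwards [self_mem_ae_restrict measurableSet_Ioi] with r hr
    have : (0 : ℝ) < r := hr
    simp only [Pi.zero_apply]; positivity
  · have := Real.integral_rpow_mul_exp_neg_mul_Ioi (a := 1 - a) (r := c) (by linarith) hc0
    rw [show 1 - a - 1 = -a by ring] at this
    rw [this]; exact hc.le

namespace IsSingularKernel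

variable {K : ℝ → Y →L[ℝ] X} {C a T : ℝ}

lemma mono {S : ℝ} (hK : IsSingularKernel K C a T) (h : S ≤ T) : IsSingularKernel K C a S :=
  ⟨hK.1, hK.2, hK.3, hK.4, fun t ht => hK.norm_le t ⟨ht.1, ht.2.trans h⟩⟩

lemma aestronglyMeasurable (hK : IsSingularKernel K C a T) {h : ℝ → Y} {b t : ℝ}
    (hm : AEStronglyMeasurable h (volume.restrict (Ioc b t))) :
    AEStronglyMeasurable (fun s => K (t - s) (h s)) (volume.restrict (Ioc b t)) := by
  rw [← restrict_Ioo_eq_restrict_Ioc] at hm ⊢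
  have hc : ContinuousOn (fun s => K (t - s)) (Ioo b t) :=
    hK.continuousOn.comp (by fun_prop) fun s hs => sub_pos.2 hs.2
  exact (ContinuousLinearMap.apply ℝ X : Y →L[ℝ] (Y →L[ℝ] X) →L[ℝ] X).aestronglyMeasurable_comp₂
    hm (hc.aestronglyMeasurable measurableSet_Ioo)

lemma norm_apply_le (hK : IsSingularKernel K C a T) {h : ℝ → Y} {b t M s : ℝ} (hb : 0 ≤ b)
    (htT : t ≤ T) (hs : s ∈ Ioo b t) (hM : ‖h s‖ ≤ M) :
    ‖K (t - s) (h s)‖ ≤ C * (t - s) ^ (-a) * M := by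
  have h1 := hK.norm_le (t - s) ⟨sub_pos.2 hs.2, by linarith [hs.1]⟩
  exact ((K (t - s)).le_opNorm _).trans
    (mul_le_mul h1 hM (norm_nonneg _) ((norm_nonneg _).trans h1))

lemma ae_norm_apply_le (hK : IsSingularKernel K C a T) {h : ℝ → Y} {b t : ℝ} {φ : ℝ → ℝ}
    (hb : 0 ≤ b) (htT : t ≤ T) (hM : ∀ s ∈ Ioo b t, ‖h s‖ ≤ φ s) :
    ∀ᵐ s ∂volume, s ∈ Ioc b t → ‖K (t - s) (h s)‖ ≤ C * (t - s) ^ (-a) * φ s := by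
  filter_upwards [compl_mem_ae_iff.2 (measure_singleton (μ := volume) t)] with s hs hs'
  have hs'' : s ∈ Ioo b t := ⟨hs'.1, lt_of_le_of_ne hs'.2 hs⟩
  exact hK.norm_apply_le hb htT hs'' (hM s hs'')

lemma intervalIntegrable (hK : IsSingularKernel K C a T) {h : ℝ → Y} {b t M : ℝ} (hb : 0 ≤ b)
    (hbt : b ≤ t) (htT : t ≤ T) (hm : AEStronglyMeasurable h (volume.restrict (Ioc b t)))
    (hM : ∀ s ∈ Ioo b t, ‖h s‖ ≤ M) :
    IntervalIntegrable (fun s => K (t - s) (h s)) volume b t := by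
  refine (((intervalIntegrable_sub_rpow_neg hK.exponent_lt_one t b t).const_mul C).mul_const
    M).mono_fun (by rw [uIoc_of_le hbt]; exact hK.aestronglyMeasurable hm) ?_
  rw [uIoc_of_le hbt]
  filter_upwards [(ae_restrict_iff' measurableSet_Ioc).2
    (hK.ae_norm_apply_le (φ := fun _ => M) hb htT hM)] with s hs
  exact hs.trans (le_abs_self _)

lemma norm_integral_le (hK : IsSingularKernel K C a T) {h : ℝ → Y} {b t M : ℝ} (hb : 0 ≤ b)
    (hbt : b ≤ t) (htT : t ≤ T) (hM : ∀ s ∈ Ioo b t, ‖h s‖ ≤ M) :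
    ‖∫ s in b..t, K (t - s) (h s)‖ ≤ C * M * ((t - b) ^ (1 - a) / (1 - a)) := by
  refine (intervalIntegral.norm_integral_le_of_norm_le hbt
    (hK.ae_norm_apply_le (φ := fun _ => M) hb htT hM)
    (((intervalIntegrable_sub_rpow_neg hK.exponent_lt_one t b t).const_mul C).mul_const M)).trans
    (le_of_eq ?_)
  rw [intervalIntegral.integral_mul_const, intervalIntegral.integral_const_mul,
    integral_sub_rpow_neg hK.exponent_lt_one]
  ring

/-- The contribution to `K * h` of the times `s ≤ t - δ` is continuous in `t`: there the kernel is
bounded. -/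
lemma continuousOn_truncated (hK : IsSingularKernel K C a T) {h : ℝ → Y} {M δ : ℝ} (hδ : 0 < δ)
    (hm : AEStronglyMeasurable h (volume.restrict (Ioc 0 T)))
    (hM : ∀ s ∈ Ioo 0 T, ‖h s‖ ≤ M) :
    ContinuousOn (fun t => ∫ s in (0 : ℝ)..max 0 (t - δ), K (t - s) (h s)) (Icc 0 T) := by
  rcases lt_or_ge T 0 with hT | hT
  · simp [Icc_eq_empty (not_le.2 hT)]
  have heq : ∀ t ∈ Icc 0 T, ∫ s in (0 : ℝ)..max 0 (t - δ), K (t - s) (h s)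
      = ∫ s in (0 : ℝ)..T, (Ici δ).indicator K (t - s) (h s) := by
    intro t ht
    rw [intervalIntegral.integral_of_le (le_max_left _ _), intervalIntegral.integral_of_le hT]
    have hind : ∀ s, (Ici δ).indicator K (t - s) (h s)
        = (Iic (t - δ)).indicator (fun s => K (t - s) (h s)) s := by
      intro s
      by_cases hs : s ≤ t - δ
      · rw [indicator_of_mem (show t - s ∈ Ici δ by simp only [mem_Ici]; linarith),
          indicator_of_mem (show s ∈ Iic (t - δ) from hs)]
      · rw [indicator_of_notMem (show t - s ∉ Ici δ by simp only [mem_Ici]; linarith),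
          indicator_of_notMem (show s ∉ Iic (t - δ) from hs), zero_apply]
    simp_rw [hind]
    rw [setIntegral_indicator measurableSet_Iic]
    congr 2
    ext s
    simp only [mem_Ioc, mem_inter_iff, mem_Iic, le_max_iff]
    constructor
    · rintro ⟨h0, h1 | h1⟩
      · linarith
      · exact ⟨⟨h0, by linarith [ht.2]⟩, h1⟩
    · rintro ⟨⟨h0, _⟩, h1⟩
      exact ⟨h0, Or.inr h1⟩
  refine ContinuousOn.congr (fun t₀ ht₀ => ?_) heq
  have hKm : AEStronglyMeasurable ((Ici δ).indicator K) volume :=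
    (aestronglyMeasurable_indicator_iff measurableSet_Ici).2
      ((hK.continuousOn.mono fun x hx => hδ.trans_le hx).aestronglyMeasurable measurableSet_Ici)
  refine intervalIntegral.continuousWithinAt_of_dominated_interval
    (bound := fun _ => C * δ ^ (-a) * M) (Eventually.of_forall fun t => ?_) ?_
    intervalIntegrable_const ?_
  · rw [uIoc_of_le hT]
    have h1 : AEStronglyMeasurable (fun s => (Ici δ).indicator K (t - s)) volume :=
      hKm.comp_quasiMeasurePreserving (quasiMeasurePreserving_sub_left volume t)
    exact (ContinuousLinearMap.apply ℝ X :
      Y →L[ℝ] (Y →L[ℝ] X) →L[ℝ] X).aestronglyMeasurable_comp₂ hm h1.restrict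
  · filter_upwards [self_mem_nhdsWithin] with t ht
    filter_upwards [compl_mem_ae_iff.2 (measure_singleton (μ := volume) T)] with s hs hs'
    rw [uIoc_of_le hT] at hs'
    have hMs := hM s ⟨hs'.1, lt_of_le_of_ne hs'.2 hs⟩
    refine ((ContinuousLinearMap.le_opNorm _ _).trans
      (mul_le_mul_of_nonneg_left hMs (norm_nonneg _))).trans
      (mul_le_mul_of_nonneg_right ?_ ((norm_nonneg _).trans hMs))
    by_cases hts : δ ≤ t - s
    · rw [indicator_of_mem (show t - s ∈ Ici δ from hts)]
      refine (hK.norm_le _ ⟨by linarith, by linarith [ht.2, hs'.1]⟩).trans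
        (mul_le_mul_of_nonneg_left ?_ hK.nonneg)
      exact Real.rpow_le_rpow_of_nonpos hδ hts (by linarith [hK.exponent_nonneg])
    · rw [indicator_of_notMem (show t - s ∉ Ici δ from hts), norm_zero]
      exact mul_nonneg hK.nonneg (Real.rpow_nonneg hδ.le _)
  · filter_upwards [compl_mem_ae_iff.2 (measure_singleton (μ := volume) (t₀ - δ))] with s hs hs'
    have hne : t₀ - s ≠ δ := fun h => hs (by simp only [mem_singleton_iff]; linarith)
    have hsub : ContinuousAt (fun t => t - s) t₀ := by fun_prop
    have hc : ContinuousAt ((Ici δ).indicator K) (t₀ - s) := by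
      rcases lt_or_gt_of_ne hne with hlt | hgt
      · refine (continuousAt_const (y := (0 : Y →L[ℝ] X))).congr ?_
        filter_upwards [Iio_mem_nhds hlt] with r hr
        rw [indicator_of_notMem (show r ∉ Ici δ from not_le.2 (mem_Iio.1 hr))]
      · refine (hK.continuousOn.continuousAt (Ioi_mem_nhds (hδ.trans hgt))).congr ?_
        filter_upwards [Ioi_mem_nhds hgt] with r hr
        rw [indicator_of_mem (show r ∈ Ici δ from le_of_lt (mem_Ioi.1 hr))]
    have hc' : ContinuousAt (fun t => (Ici δ).indicator K (t - s)) t₀ :=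
      ContinuousAt.comp (f := fun t => t - s) hc hsub
    exact (hc'.clm_apply continuousAt_const).continuousWithinAt

/-- `K * h` is continuous for every bounded measurable `h`, as a uniform limit of the truncated
convolutions. No continuity of `h` is needed, which later allows an `h` that is only known to be
continuous and bounded on a half-open interval. -/
lemma continuousOn_volterraConv (hK : IsSingularKernel K C a T) {h : ℝ → Y} {M : ℝ}
    (hm : AEStronglyMeasurable h (volume.restrict (Ioc 0 T)))
    (hM : ∀ s ∈ Ioo 0 T, ‖h s‖ ≤ M) : ContinuousOn (volterraConv K h) (Icc 0 T) := by
  rcases lt_or_ge M 0 with hM0 | hM0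
  · have : Ioo 0 T = ∅ := eq_empty_of_forall_notMem fun s hs =>
      absurd ((norm_nonneg _).trans (hM s hs)) (not_le.2 hM0)
    exact (subsingleton_Icc_of_ge (Ioo_eq_empty_iff.1 this |> not_lt.1)).continuousOn _
  have hpow : Tendsto (fun δ : ℝ => C * M * (δ ^ (1 - a) / (1 - a))) (𝓝[>] 0) (𝓝 0) := by
    have h1 : ContinuousAt (fun δ : ℝ => C * M * (δ ^ (1 - a) / (1 - a))) 0 := by
      have := Real.continuousAt_rpow_const 0 (1 - a) (Or.inr (by linarith [hK.exponent_lt_one]))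
      exact continuousAt_const.mul (this.div_const _)
    have h2 := h1.tendsto
    rw [Real.zero_rpow (by linarith [hK.exponent_lt_one])] at h2
    simp only [zero_div, mul_zero] at h2
    exact h2.mono_left nhdsWithin_le_nhds
  refine continuousOn_of_uniform_approx_of_continuousOn fun u hu => ?_
  obtain ⟨e, he, heu⟩ := Metric.mem_uniformity_dist.1 hu
  obtain ⟨δ, hδe, hδ⟩ := ((hpow.eventually_lt_const he).and self_mem_nhdsWithin).exists
  replace hδ : 0 < δ := hδ
  refine ⟨_, hK.continuousOn_truncated hδ hm hM, fun t ht => heu ?_⟩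
  have hi : ∀ b c, 0 ≤ b → b ≤ c → c ≤ t →
      IntervalIntegrable (fun s => K (t - s) (h s)) volume b c := by
    intro b c hb hbc hct
    refine (hK.intervalIntegrable (M := M) le_rfl ht.1 ht.2
      (hm.mono_measure (Measure.restrict_mono (Ioc_subset_Ioc_right ht.2) le_rfl))
      fun s hs => hM s ⟨hs.1, hs.2.trans_le ht.2⟩).mono_set ?_
    rw [uIcc_of_le hbc, uIcc_of_le ht.1]
    exact Icc_subset_Icc hb hct
  have hmax : max 0 (t - δ) ≤ t := max_le ht.1 (by linarith)
  have hsplit := intervalIntegral.integral_add_adjacent_intervals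
    (hi 0 (max 0 (t - δ)) le_rfl (le_max_left _ _) hmax) (hi _ t (le_max_left _ _) hmax le_rfl)
  rw [dist_eq_norm, volterraConv, ← hsplit, add_sub_cancel_left]
  refine (hK.norm_integral_le (M := M) (le_max_left _ _) hmax ht.2 fun s hs =>
    hM s ⟨(le_max_left _ _).trans_lt hs.1, hs.2.trans_le ht.2⟩).trans_lt (lt_of_le_of_lt ?_ hδe)
  refine mul_le_mul_of_nonneg_left (div_le_div_of_nonneg_right ?_
    (by linarith [hK.exponent_lt_one])) (mul_nonneg hK.nonneg hM0)
  exact Real.rpow_le_rpow (by linarith) (by linarith [le_max_right 0 (t - δ)])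
    (by linarith [hK.exponent_lt_one])

end IsSingularKernel

lemma volterraConv_congr {K : ℝ → Y →L[ℝ] X} {h₁ h₂ : ℝ → Y} {t : ℝ} (ht : 0 ≤ t)
    (h : ∀ s ∈ Ioo 0 t, h₁ s = h₂ s) : volterraConv K h₁ t = volterraConv K h₂ t :=
  intervalIntegral.integral_congr_Ioo_of_le ht fun s hs => by simp only [h s hs]

namespace IsSingularKernel

variable {K : ℝ → Y →L[ℝ] X} {C a T : ℝ}

lemma intervalIntegrable_of_continuousOn (hK : IsSingularKernel K C a T) {h : ℝ → Y} {t : ℝ}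
    (ht : t ∈ Icc 0 T) (hc : ContinuousOn h (Icc 0 t)) :
    IntervalIntegrable (fun s => K (t - s) (h s)) volume 0 t := by
  obtain ⟨N, hN⟩ := isCompact_Icc.exists_bound_of_continuousOn hc
  exact hK.intervalIntegrable (M := N) le_rfl ht.1 ht.2
    ((hc.mono Ioc_subset_Icc_self).aestronglyMeasurable measurableSet_Ioc)
    fun s hs => hN s (Ioo_subset_Icc_self hs)

lemma volterraConv_sub (hK : IsSingularKernel K C a T) {h₁ h₂ : ℝ → Y} {t : ℝ}
    (ht : t ∈ Icc 0 T) (hc₁ : ContinuousOn h₁ (Icc 0 t)) (hc₂ : ContinuousOn h₂ (Icc 0 t)) :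
    volterraConv K h₁ t - volterraConv K h₂ t = volterraConv K (fun s => h₁ s - h₂ s) t := by
  unfold volterraConv
  rw [← intervalIntegral.integral_sub (hK.intervalIntegrable_of_continuousOn ht hc₁)
    (hK.intervalIntegrable_of_continuousOn ht hc₂)]
  simp only [map_sub]

lemma norm_volterraConv_sub_le (hK : IsSingularKernel K C a T) {h₁ h₂ : ℝ → Y} {b t M : ℝ}
    (hb : 0 ≤ b) (hbt : b ≤ t) (htT : t ≤ T) (hc₁ : ContinuousOn h₁ (Icc 0 t))
    (hc₂ : ContinuousOn h₂ (Icc 0 t)) (heq : ∀ s ∈ Ioo 0 b, h₁ s = h₂ s)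
    (hM : ∀ s ∈ Ioo b t, ‖h₁ s - h₂ s‖ ≤ M) :
    ‖volterraConv K h₁ t - volterraConv K h₂ t‖ ≤ C * M * ((t - b) ^ (1 - a) / (1 - a)) := by
  have ht : t ∈ Icc 0 T := ⟨hb.trans hbt, htT⟩
  have hi : IntervalIntegrable (fun s => K (t - s) (h₁ s - h₂ s)) volume 0 t :=
    hK.intervalIntegrable_of_continuousOn ht (hc₁.sub hc₂)
  have hb' : b ∈ uIcc 0 t := by rw [uIcc_of_le ht.1]; exact ⟨hb, hbt⟩
  rw [hK.volterraConv_sub ht hc₁ hc₂, volterraConv,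
    ← intervalIntegral.integral_add_adjacent_intervals
      (hi.mono_set (uIcc_subset_uIcc_left hb')) (hi.mono_set (uIcc_subset_uIcc_right hb')),
    intervalIntegral.integral_congr_Ioo_of_le hb
      (fun s hs => by simp only [heq s hs, sub_self, map_zero] :
        (Ioo 0 b).EqOn (fun s => K (t - s) (h₁ s - h₂ s)) (fun _ => 0)),
    intervalIntegral.integral_zero, zero_add]
  exact hK.norm_integral_le hb hbt htT hM

lemma norm_volterraConv_le_exp (hK : IsSingularKernel K C a T) {h : ℝ → Y} {t B D c : ℝ}
    (ht : t ∈ Icc 0 T) (hD : 0 ≤ D)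
    (hc : ∫ s in (0 : ℝ)..t, (t - s) ^ (-a) * Real.exp (c * s) ≤ B * Real.exp (c * t))
    (hh : ∀ s ∈ Ioo 0 t, ‖h s‖ ≤ D * Real.exp (c * s)) :
    ‖volterraConv K h t‖ ≤ C * D * (B * Real.exp (c * t)) := by
  have hi : IntervalIntegrable (fun s => C * (t - s) ^ (-a) * (D * Real.exp (c * s)))
      volume 0 t :=
    ((intervalIntegrable_sub_rpow_neg hK.exponent_lt_one t 0 t).const_mul C).mul_continuousOn
      (by fun_prop)
  refine (intervalIntegral.norm_integral_le_of_norm_le ht.1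
    (hK.ae_norm_apply_le le_rfl ht.2 hh) hi).trans ?_
  have : (fun s => C * (t - s) ^ (-a) * (D * Real.exp (c * s)))
      = fun s => C * D * ((t - s) ^ (-a) * Real.exp (c * s)) := by funext s; ring
  rw [this, intervalIntegral.integral_const_mul]
  exact mul_le_mul_of_nonneg_left hc (mul_nonneg hK.nonneg hD)

lemma continuousOn_volterraConv_of_continuousOn (hK : IsSingularKernel K C a T) {h : ℝ → Y}
    (hc : ContinuousOn h (Icc 0 T)) : ContinuousOn (volterraConv K h) (Icc 0 T) := by
  obtain ⟨N, hN⟩ := isCompact_Icc.exists_bound_of_continuousOn hc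
  exact hK.continuousOn_volterraConv
    ((hc.mono Ioc_subset_Icc_self).aestronglyMeasurable measurableSet_Ioc)
    fun s hs => hN s (Ioo_subset_Icc_self hs)

end IsSingularKernel

end Volterra

/-! ### Uniformity around compact sets -/

section Tube

variable {X Y : Type*} [NormedAddCommGroup X] [NormedAddCommGroup Y] {F : X → Y}

/-- A locally Lipschitz map satisfies a Lipschitz bound with one constant between a compact set and
a tube around it. -/
lemma LocallyLipschitz.exists_lipschitz_tube (hF : LocallyLipschitz F) {S : Set X}
    (hS : IsCompact S) :
    ∃ ρ > 0, ∃ L ≥ 0, ∀ y ∈ S, ∀ x, ‖x - y‖ ≤ ρ → ‖F x - F y‖ ≤ L * ‖x - y‖ := by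
  refine hS.induction_on (p := fun S => ∃ ρ > 0, ∃ L ≥ 0, ∀ y ∈ S, ∀ x, ‖x - y‖ ≤ ρ →
    ‖F x - F y‖ ≤ L * ‖x - y‖) ⟨1, one_pos, 0, le_rfl, by simp⟩ ?_ ?_ ?_
  · rintro s t hst ⟨ρ, hρ, L, hL, h⟩
    exact ⟨ρ, hρ, L, hL, fun y hy => h y (hst hy)⟩
  · rintro s t ⟨ρ₁, hρ₁, L₁, hL₁, h₁⟩ ⟨ρ₂, hρ₂, L₂, hL₂, h₂⟩
    refine ⟨min ρ₁ ρ₂, lt_min hρ₁ hρ₂, max L₁ L₂, hL₁.le.trans (le_max_left _ _), ?_⟩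
    rintro y (hy | hy) x hx
    · exact (h₁ y hy x (hx.trans (min_le_left _ _))).trans
        (mul_le_mul_of_nonneg_right (le_max_left _ _) (norm_nonneg _))
    · exact (h₂ y hy x (hx.trans (min_le_right _ _))).trans
        (mul_le_mul_of_nonneg_right (le_max_right _ _) (norm_nonneg _))
  · intro p _
    obtain ⟨L, U, hU, hLip⟩ := hF p
    obtain ⟨r, hr, hrU⟩ := Metric.mem_nhds_iff.1 hU
    refine ⟨Metric.ball p (r / 2),
      mem_nhdsWithin_of_mem_nhds (Metric.ball_mem_nhds p (by linarith)), r / 4, by linarith, L, L.2, fun y hy x hx => ?_⟩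
    rw [Metric.mem_ball] at hy
    have hx' : dist x p < r := (dist_triangle x y p).trans_lt (by rw [dist_eq_norm x y]; linarith)
    have := hLip.dist_le_mul x (hrU hx') y (hrU (Metric.mem_ball.2 (by linarith)))
    simpa only [dist_eq_norm] using this

/-- Locally uniform convergence is uniform on a tube around a compact set. -/
lemma exists_tendsto_tube {ι : Type*} {l : Filter ι} {Fn : ι → X → Y}
    (hconv : ∀ x, ∃ U ∈ 𝓝 x, TendstoUniformlyOn Fn F l U) {S : Set X} (hS : IsCompact S) :
    ∃ ρ > 0, ∀ η > 0, ∀ᶠ n in l, ∀ y ∈ S, ∀ x, ‖x - y‖ ≤ ρ → ‖Fn n x - F x‖ ≤ η := by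
  refine hS.induction_on (p := fun S => ∃ ρ > 0, ∀ η > 0, ∀ᶠ n in l, ∀ y ∈ S, ∀ x, ‖x - y‖ ≤ ρ →
    ‖Fn n x - F x‖ ≤ η) ⟨1, one_pos, by simp⟩ ?_ ?_ ?_
  · rintro s t hst ⟨ρ, hρ, h⟩
    exact ⟨ρ, hρ, fun η hη => (h η hη).mono fun n hn y hy => hn y (hst hy)⟩
  · rintro s t ⟨ρ₁, hρ₁, h₁⟩ ⟨ρ₂, hρ₂, h₂⟩
    refine ⟨min ρ₁ ρ₂, lt_min hρ₁ hρ₂, fun η hη => ?_⟩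
    filter_upwards [h₁ η hη, h₂ η hη] with n hn₁ hn₂
    rintro y (hy | hy) x hx
    · exact hn₁ y hy x (hx.trans (min_le_left _ _))
    · exact hn₂ y hy x (hx.trans (min_le_right _ _))
  · intro p _
    obtain ⟨U, hU, hlim⟩ := hconv p
    obtain ⟨r, hr, hrU⟩ := Metric.mem_nhds_iff.1 hU
    refine ⟨Metric.ball p (r / 2),
      mem_nhdsWithin_of_mem_nhds (Metric.ball_mem_nhds p (by linarith)), r / 4, by linarith, fun η hη => ?_⟩
    filter_upwards [Metric.tendstoUniformlyOn_iff.1 hlim η hη] with n hn y hy x hx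
    rw [Metric.mem_ball] at hy
    have hx' : dist x p < r := (dist_triangle x y p).trans_lt (by rw [dist_eq_norm x y]; linarith)
    have := hn x (hrU hx')
    rw [dist_comm, dist_eq_norm] at this
    exact this.le

end Tube

/-! ### Volterra equations: stability and uniqueness -/

section VolterraEquation

variable {X Y : Type*} [NormedAddCommGroup X] [NormedSpace ℝ X] [NormedAddCommGroup Y]
  [NormedSpace ℝ Y]

/-- `u` is a continuous solution on `[0, T]` of `u(t) = g(t) + ∫₀ᵗ K(t - s) F(u(s)) ds`. -/
structure IsVolterraSolution (K : ℝ → Y →L[ℝ] X) (F : X → Y) (g : ℝ → X) (T : ℝ) (u : ℝ → X) :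
    Prop where
  continuousOn : ContinuousOn u (Icc 0 T)
  eq : ∀ t ∈ Icc 0 T, u t = g t + volterraConv K (fun s => F (u s)) t

variable {K : ℝ → Y →L[ℝ] X} {C a T : ℝ} {F : X → Y} {g : ℝ → X}

lemma isVolterraSolution_zero (g : ℝ → X) :
    IsVolterraSolution K F g 0 (fun _ => g 0) := by
  refine ⟨continuousOn_const, fun t ht => ?_⟩
  obtain rfl : t = 0 := le_antisymm ht.2 ht.1
  simp [volterraConv]

lemma IsVolterraSolution.mono {u : ℝ → X} {S : ℝ} (hu : IsVolterraSolution K F g T u)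
    (h : S ≤ T) : IsVolterraSolution K F g S u :=
  ⟨hu.1.mono (Icc_subset_Icc_right h), fun t ht => hu.eq t ⟨ht.1, ht.2.trans h⟩⟩

lemma IsVolterraSolution.congr {u w : ℝ → X} (hu : IsVolterraSolution K F g T u)
    (h : ∀ t ∈ Icc 0 T, w t = u t) : IsVolterraSolution K F g T w :=
  ⟨hu.1.congr h, fun t ht => by
    rw [h t ht, hu.eq t ht]
    congr 1
    exact volterraConv_congr ht.1 fun s hs => by rw [h s ⟨hs.1.le, hs.2.le.trans ht.2⟩]⟩

/-- First-exit argument: a continuous function that starts below `ρ` and improves the bound `ρ` to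
`b < ρ` on every interval on which it holds, is bounded by `b` throughout. -/
lemma le_of_bootstrap {φ : ℝ → ℝ} {τ b ρ : ℝ} (hφ : ContinuousOn φ (Icc 0 τ)) (hb : b < ρ)
    (h0 : φ 0 ≤ b)
    (himp : ∀ t ∈ Icc 0 τ, (∀ s ∈ Icc 0 t, φ s ≤ ρ) → ∀ s ∈ Icc 0 t, φ s ≤ b) :
    ∀ t ∈ Icc 0 τ, φ t ≤ b := by
  have hρ : ∀ t ∈ Icc 0 τ, φ t ≤ ρ := by
    by_contra! hcon
    obtain ⟨t₁, ht₁, hlt⟩ := hcon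
    have hZc : IsCompact (Icc 0 τ ∩ φ ⁻¹' {ρ}) :=
      isCompact_Icc.of_isClosed_subset (hφ.preimage_isClosed_of_isClosed isClosed_Icc
        isClosed_singleton) inter_subset_left
    have hivt : ∀ t ∈ Icc 0 τ, ρ < φ t → ∃ s ∈ Icc 0 t, φ s = ρ := fun t ht hρt =>
      intermediate_value_Icc ht.1 (hφ.mono (Icc_subset_Icc_right ht.2))
        ⟨h0.trans hb.le, hρt.le⟩
    obtain ⟨z, hz, hzρ⟩ := hivt t₁ ht₁ hlt
    obtain ⟨m, ⟨hm, hmρ⟩, hmin⟩ := hZc.exists_isLeast ⟨z, ⟨hz.1, hz.2.trans ht₁.2⟩, hzρ⟩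
    have hle : ∀ s ∈ Icc 0 m, φ s ≤ ρ := by
      intro s hs
      by_contra! hsρ
      obtain ⟨r, hr, hrρ⟩ := hivt s ⟨hs.1, hs.2.trans hm.2⟩ hsρ
      have := hmin ⟨⟨hr.1, hr.2.trans (hs.2.trans hm.2)⟩, hrρ⟩
      have hsm : s = m := le_antisymm hs.2 (this.trans hr.2)
      rw [hsm] at hsρ
      exact absurd hmρ hsρ.ne'
    have h1 := himp m hm hle m ⟨hm.1, le_rfl⟩
    have h2 : φ m = ρ := hmρ
    linarith
  exact fun t ht => himp t ht (fun s hs => hρ s ⟨hs.1, hs.2.trans ht.2⟩) t ⟨ht.1, le_rfl⟩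

/-- Stability of the Volterra equation. If `F` satisfies a Lipschitz bound along the trajectory of a
solution `u` up to distance `ρ`, then a perturbation of size `η` of `F` (in that tube) and of `g`
moves solutions by at most `M η`, as long as this is less than `ρ`; the perturbed nonlinearity needs
no Lipschitz bound, and the perturbed solution is not assumed to remain in the tube. -/
theorem IsVolterraSolution.stability (hK : IsSingularKernel K C a T) {u : ℝ → X}
    (hu : IsVolterraSolution K F g T u) (hF : Continuous F) {ρ L : ℝ} (hL : 0 ≤ L)
    (hLip : ∀ s ∈ Icc 0 T, ∀ x, ‖x - u s‖ ≤ ρ → ‖F x - F (u s)‖ ≤ L * ‖x - u s‖) :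
    ∃ M > 0, ∀ η ≥ 0, M * η < ρ → ∀ (F' : X → Y) (g' : ℝ → X), Continuous F' →
      (∀ s ∈ Icc 0 T, ∀ x, ‖x - u s‖ ≤ ρ → ‖F' x - F x‖ ≤ η) →
      (∀ t ∈ Icc 0 T, ‖g' t - g t‖ ≤ η) →
      ∀ τ ≤ T, ∀ w, IsVolterraSolution K F' g' τ w → ∀ t ∈ Icc 0 τ, ‖w t - u t‖ ≤ M * η := by
  have hC := hK.nonneg
  -- the weight is chosen such that `C * B * L ≤ 1 / 2` and `C * B ≤ 1`
  set B : ℝ := 1 / (2 * (C + 1) * (L + 1)) with hB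
  have hB0 : 0 < B := by positivity
  have hCBL : C * B * L ≤ 1 / 2 := by
    rw [hB]; field_simp; nlinarith
  have hCB : C * B ≤ 1 := by
    rw [hB]; field_simp; nlinarith [mul_nonneg hC hL]
  obtain ⟨c, hc0, hc⟩ := exists_exp_weight hK.exponent_lt_one hB0
  refine ⟨4 * Real.exp (c * max T 0), by positivity, ?_⟩
  intro η hη hMη F' g' hF' hFF hgg τ hτ w hw t₀ ht₀
  have hT0 : 0 ≤ T := (ht₀.1.trans ht₀.2).trans hτ
  rw [max_eq_left hT0] at hMη ⊢
  have hexp1 : ∀ s : ℝ, 0 ≤ s → 1 ≤ Real.exp (c * s) := fun s hs =>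
    Real.one_le_exp (mul_nonneg hc0 hs)
  have hcw : ContinuousOn (fun t => ‖w t - u t‖) (Icc 0 τ) :=
    (hw.continuousOn.sub (hu.continuousOn.mono (Icc_subset_Icc_right hτ))).norm
  refine le_of_bootstrap hcw hMη ?_ ?_ t₀ ht₀
  · have h0 : (0 : ℝ) ∈ Icc 0 τ := ⟨le_rfl, ht₀.1.trans ht₀.2⟩
    have h0' : (0 : ℝ) ∈ Icc 0 T := ⟨le_rfl, hT0⟩
    rw [hw.eq 0 h0, hu.eq 0 h0']
    simp only [volterraConv, intervalIntegral.integral_same, add_zero]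
    refine (hgg 0 h0').trans ?_
    nlinarith [hexp1 T hT0]
  intro t ht hρ
  have htT : t ≤ T := ht.2.trans hτ
  -- the maximum `N` of the weighted difference
  have hcN : ContinuousOn (fun s => Real.exp (-(c * s)) * ‖w s - u s‖) (Icc 0 t) :=
    (by fun_prop : Continuous fun s => Real.exp (-(c * s))).continuousOn.mul
      (hcw.mono (Icc_subset_Icc_right ht.2))
  obtain ⟨s₀, hs₀, hmax⟩ := isCompact_Icc.exists_isMaxOn (nonempty_Icc.2 ht.1) hcN
  set N := Real.exp (-(c * s₀)) * ‖w s₀ - u s₀‖ with hN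
  have hN0 : 0 ≤ N := by positivity
  have hφN : ∀ s ∈ Icc 0 t, ‖w s - u s‖ ≤ N * Real.exp (c * s) := by
    intro s hs
    have h1 : Real.exp (-(c * s)) * ‖w s - u s‖ ≤ N := hmax hs
    have h2 := mul_le_mul_of_nonneg_right h1 (Real.exp_pos (c * s)).le
    rwa [mul_right_comm, ← Real.exp_add, neg_add_cancel, Real.exp_zero, one_mul] at h2
  have hs₀T : s₀ ∈ Icc 0 T := ⟨hs₀.1, hs₀.2.trans htT⟩
  have hcF : ContinuousOn (fun s => F (u s)) (Icc 0 s₀) :=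
    hF.comp_continuousOn (hu.continuousOn.mono (Icc_subset_Icc_right hs₀T.2))
  have hcF' : ContinuousOn (fun s => F' (w s)) (Icc 0 s₀) :=
    hF'.comp_continuousOn (hw.continuousOn.mono (Icc_subset_Icc_right (hs₀.2.trans ht.2)))
  have hconv : ‖volterraConv K (fun s => F' (w s) - F (u s)) s₀‖
      ≤ C * (η + L * N) * (B * Real.exp (c * s₀)) := by
    refine hK.norm_volterraConv_le_exp hs₀T (by positivity) (hc s₀ hs₀.1) fun s hs => ?_
    have hs' : s ∈ Icc 0 t := ⟨hs.1.le, hs.2.le.trans hs₀.2⟩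
    have hsT : s ∈ Icc 0 T := ⟨hs'.1, hs'.2.trans htT⟩
    have h1 := hFF s hsT (w s) (hρ s hs')
    have h2 := hLip s hsT (w s) (hρ s hs')
    have h3 : ‖F' (w s) - F (u s)‖ ≤ ‖F' (w s) - F (w s)‖ + ‖F (w s) - F (u s)‖ := by
      rw [← sub_add_sub_cancel (F' (w s)) (F (w s)) (F (u s))]; exact norm_add_le _ _
    have h4 := mul_le_mul_of_nonneg_left (hφN s hs') hL
    have h5 := mul_le_mul_of_nonneg_left (hexp1 s hs'.1) hη
    linarith
  have hdiff : ‖w s₀ - u s₀‖ ≤ η + C * (η + L * N) * (B * Real.exp (c * s₀)) := by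
    rw [hw.eq s₀ ⟨hs₀.1, hs₀.2.trans ht.2⟩, hu.eq s₀ hs₀T, add_sub_add_comm,
      hK.volterraConv_sub hs₀T hcF' hcF]
    exact (norm_add_le _ _).trans (add_le_add (hgg s₀ hs₀T) hconv)
  have hNle : N ≤ η + C * (η + L * N) * B := by
    have hle1 : Real.exp (-(c * s₀)) ≤ 1 := Real.exp_le_one_iff.2 (by
      have := mul_nonneg hc0 hs₀.1; linarith)
    calc N ≤ Real.exp (-(c * s₀)) * (η + C * (η + L * N) * (B * Real.exp (c * s₀))) :=
          mul_le_mul_of_nonneg_left hdiff (Real.exp_pos _).le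
      _ = Real.exp (-(c * s₀)) * η
          + C * (η + L * N) * B * (Real.exp (-(c * s₀)) * Real.exp (c * s₀)) := by ring
      _ ≤ η + C * (η + L * N) * B := by
          rw [← Real.exp_add, neg_add_cancel, Real.exp_zero, mul_one]
          nlinarith
  have hN4 : N ≤ 4 * η := by nlinarith
  intro s hs
  refine (hφN s hs).trans ?_
  have h1 : Real.exp (c * s) ≤ Real.exp (c * T) :=
    Real.exp_le_exp.2 (mul_le_mul_of_nonneg_left (hs.2.trans htT) hc0)
  have h2 : N * Real.exp (c * s) ≤ 4 * η * Real.exp (c * T) :=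
    mul_le_mul hN4 h1 (Real.exp_pos _).le (by positivity)
  linarith

/-- Uniqueness: stability under the zero perturbation. -/
theorem IsVolterraSolution.unique (hK : IsSingularKernel K C a T) (hF : LocallyLipschitz F)
    {u w : ℝ → X} (hu : IsVolterraSolution K F g T u) (hw : IsVolterraSolution K F g T w) :
    ∀ t ∈ Icc 0 T, w t = u t := by
  obtain ⟨ρ, hρ, L, hL, hLip⟩ :=
    hF.exists_lipschitz_tube (isCompact_Icc.image_of_continuousOn hu.continuousOn)
  obtain ⟨M, _, h⟩ := hu.stability hK hF.continuous hL
    (fun s hs x hx => hLip (u s) (mem_image_of_mem u hs) x hx)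
  intro t ht
  have := h 0 le_rfl (by simpa using hρ) F g hF.continuous (by simp) (by simp) T le_rfl w hw t ht
  rw [mul_zero] at this
  exact sub_eq_zero.1 (norm_le_zero_iff.1 this)

end VolterraEquation

/-! ### Volterra equations: local and global existence -/

section VolterraExistence

variable {X Y : Type*} [NormedAddCommGroup X] [NormedSpace ℝ X] [CompleteSpace X]
  [NormedAddCommGroup Y] [NormedSpace ℝ Y]
  {K : ℝ → Y →L[ℝ] X} {C a T : ℝ} {F : X → Y} {g : ℝ → X}

/-- A solution on `[0, τ]`, `τ < T`, extends to a larger interval. The extension is a fixed point of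
`w ↦ g + K * F(w)` among the continuous functions on `[0, τ']` that agree with the given solution
on `[0, τ]` and remain close to its final value on `[τ, τ']`; keeping the past in the equation
makes a semigroup property of `K` unnecessary. -/
theorem IsVolterraSolution.exists_extension (hK : IsSingularKernel K C a T)
    (hF : LocallyLipschitz F) (hg : ContinuousOn g (Icc 0 T)) {τ : ℝ} (hτ : τ ∈ Ico 0 T)
    {w : ℝ → X} (hw : IsVolterraSolution K F g τ w) :
    ∃ τ' ∈ Ioc τ T, ∃ w', IsVolterraSolution K F g τ' w' := by
  obtain ⟨L, U, hU, hLip⟩ := hF (w τ)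
  obtain ⟨r, hr, hrU⟩ := Metric.nhds_basis_closedBall.mem_iff.1 hU
  have ha := hK.exponent_lt_one
  have hC := hK.nonneg
  -- the solution, continued by the constant `w τ`
  set w₀ : ℝ → X := fun s => w (max 0 (min s τ)) with hw₀
  have hw₀c : Continuous w₀ := hw.continuousOn.comp_continuous (by fun_prop) fun s =>
    ⟨le_max_left _ _, max_le hτ.1 (min_le_right _ _)⟩
  have hw₀l : ∀ s ∈ Icc 0 τ, w₀ s = w s := fun s hs => by
    simp only [hw₀, min_eq_left hs.2, max_eq_right hs.1]
  have hw₀r : ∀ s, τ ≤ s → w₀ s = w τ := fun s hs => by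
    simp only [hw₀, min_eq_right hs, max_eq_right hτ.1]
  have hFw₀ : Continuous fun s => F (w₀ s) := hF.continuous.comp hw₀c
  set G : ℝ → X := fun t => g t + volterraConv K (fun s => F (w₀ s)) t with hG
  have hGc : ContinuousOn G (Icc 0 T) :=
    hg.add (hK.continuousOn_volterraConv_of_continuousOn hFw₀.continuousOn)
  have hGl : ∀ t ∈ Icc 0 τ, G t = w t := fun t ht => by
    rw [hw.eq t ht, hG]
    simp only
    congr 1
    exact volterraConv_congr ht.1 fun s hs => by rw [hw₀l s ⟨hs.1.le, hs.2.le.trans ht.2⟩]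
  have hτT : τ ∈ Icc 0 T := ⟨hτ.1, hτ.2.le⟩
  obtain ⟨δ₁, hδ₁, hGδ⟩ := Metric.continuousOn_iff.1 hGc τ hτT (r / 2) (by linarith)
  -- the step is short enough for the Lipschitz constant of the fixed point map to be at most `1/2`
  have hpow : ∀ᶠ δ : ℝ in 𝓝[>] 0, C * L * (δ ^ (1 - a) / (1 - a)) < 1 / 2 := by
    have h1 : ContinuousAt (fun δ : ℝ => C * L * (δ ^ (1 - a) / (1 - a))) 0 :=
      continuousAt_const.mul
        ((Real.continuousAt_rpow_const 0 (1 - a) (Or.inr (by linarith))).div_const _)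
    refine nhdsWithin_le_nhds (h1.eventually_lt_const ?_)
    simp only [Real.zero_rpow (show (1 - a) ≠ 0 by linarith)]; norm_num
  obtain ⟨δ, ⟨hδ, hδδ₁⟩, hδ0⟩ :=
    ((hpow.and (nhdsWithin_le_nhds (Iio_mem_nhds hδ₁))).and self_mem_nhdsWithin).exists
  replace hδ0 : 0 < δ := hδ0
  set τ' := min (τ + δ) T with hτ'
  have hττ' : τ < τ' := lt_min (by linarith) hτ.2
  have hτ'T : τ' ≤ T := min_le_right _ _
  have hτ'0 : 0 ≤ τ' := hτ.1.trans hττ'.le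
  have hstep : ∀ M, 0 ≤ M → ∀ t ∈ Icc τ τ',
      C * (L * M) * ((t - τ) ^ (1 - a) / (1 - a)) ≤ 1 / 2 * M := by
    intro M hM t ht
    have h1 : (t - τ) ^ (1 - a) ≤ δ ^ (1 - a) :=
      Real.rpow_le_rpow (by linarith [ht.1]) (by linarith [ht.2, min_le_left (τ + δ) T])
        (by linarith)
    have h2 : C * L * ((t - τ) ^ (1 - a) / (1 - a)) ≤ C * L * (δ ^ (1 - a) / (1 - a)) :=
      mul_le_mul_of_nonneg_left (div_le_div_of_nonneg_right h1 (by linarith))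
        (mul_nonneg hC L.2)
    have h3 := mul_le_mul_of_nonneg_right (h2.trans hδ.le) hM
    calc _ = C * L * ((t - τ) ^ (1 - a) / (1 - a)) * M := by ring
      _ ≤ _ := h3
  have hFe : ∀ f : C(Icc 0 τ', X), Continuous fun s => F (IccExtend hτ'0 f s) := fun f =>
    hF.continuous.comp f.continuous.Icc_extend'
  let Φ : C(Icc 0 τ', X) → C(Icc 0 τ', X) := fun f =>
    ⟨fun t => g t + volterraConv K (fun s => F (IccExtend hτ'0 f s)) t,
      ((hg.mono (Icc_subset_Icc_right hτ'T)).add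
        ((hK.mono hτ'T).continuousOn_volterraConv_of_continuousOn
          (hFe f).continuousOn)).domRestrict⟩
  let S : Set C(Icc 0 τ', X) :=
    {f | ∀ t : Icc 0 τ', ((t : ℝ) ≤ τ → f t = w₀ t) ∧ (τ ≤ t → f t ∈ Metric.closedBall (w τ) r)}
  have hSc : IsComplete S := by
    refine IsClosed.isComplete ?_
    have : S = ⋂ t : Icc 0 τ', {f | ((t : ℝ) ≤ τ → f t = w₀ t) ∧
        (τ ≤ t → f t ∈ Metric.closedBall (w τ) r)} := by ext f; simp [S]
    rw [this]
    refine isClosed_iInter fun t => ?_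
    have hev : Continuous fun f : C(Icc 0 τ', X) => f t := continuous_eval_const t
    exact (isClosed_imp isOpen_const (isClosed_eq hev continuous_const)).inter
      (isClosed_imp isOpen_const (Metric.isClosed_closedBall.preimage hev))
  have hSl : ∀ f ∈ S, ∀ s ∈ Ioo 0 τ, IccExtend hτ'0 f s = w₀ s := fun f hf s hs => by
    have hs' : s ∈ Icc 0 τ' := ⟨hs.1.le, (hs.2.trans hττ').le⟩
    rw [IccExtend_of_mem _ _ hs']
    exact (hf ⟨s, hs'⟩).1 hs.2.le
  have hSr : ∀ f ∈ S, ∀ t ∈ Icc τ τ', ∀ s ∈ Ioo τ t,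
      IccExtend hτ'0 f s ∈ Metric.closedBall (w τ) r := fun f hf t ht s hs => by
    have hs' : s ∈ Icc 0 τ' := ⟨hτ.1.trans hs.1.le, hs.2.le.trans ht.2⟩
    rw [IccExtend_of_mem _ _ hs']
    exact (hf ⟨s, hs'⟩).2 hs.1.le
  have hΦl : ∀ f ∈ S, ∀ t : Icc 0 τ', (t : ℝ) ≤ τ → Φ f t = w₀ t := by
    intro f hf t ht
    rw [hw₀l t ⟨t.2.1, ht⟩, ← hGl t ⟨t.2.1, ht⟩]
    change g t + _ = g t + _
    congr 1
    exact volterraConv_congr t.2.1 fun s hs => by rw [hSl f hf s ⟨hs.1, hs.2.trans_le ht⟩]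
  have hmaps : MapsTo Φ S S := by
    intro f hf t
    refine ⟨hΦl f hf t, fun ht => ?_⟩
    have htt : (t : ℝ) ∈ Icc τ τ' := ⟨ht, t.2.2⟩
    have h1 : ‖Φ f t - G t‖ ≤ 1 / 2 * r := by
      change ‖g t + volterraConv K _ t - (g t + volterraConv K _ t)‖ ≤ _
      rw [add_sub_add_left_eq_sub]
      refine (hK.norm_volterraConv_sub_le (M := L * r) hτ.1 ht (t.2.2.trans hτ'T)
        (hFe f).continuousOn hFw₀.continuousOn
        (fun s hs => by rw [hSl f hf s hs]) fun s hs => ?_).trans (hstep r hr.le t htt)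
      have hb := hSr f hf t htt s hs
      rw [hw₀r s hs.1.le, ← dist_eq_norm]
      exact (hLip.dist_le_mul _ (hrU hb) _ (hrU (Metric.mem_closedBall_self hr.le))).trans
        (mul_le_mul_of_nonneg_left hb L.2)
    have h2 : dist (G t) (w τ) < r / 2 := by
      rw [← hGl τ ⟨hτ.1, le_rfl⟩]
      refine hGδ t ⟨t.2.1, t.2.2.trans hτ'T⟩ ?_
      have h3 : τ' ≤ τ + δ := min_le_left _ _
      have h4 : δ < δ₁ := hδδ₁
      rw [Real.dist_eq, abs_of_nonneg (by linarith)]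
      linarith [t.2.2]
    rw [Metric.mem_closedBall]
    have := dist_triangle (Φ f t) (G t) (w τ)
    rw [dist_eq_norm (Φ f t) (G t)] at this
    linarith
  have hcontr : ContractingWith (1 / 2) (hmaps.restrict Φ S S) := by
    refine ⟨by norm_num, LipschitzWith.of_dist_le_mul fun f₁ f₂ => ?_⟩
    change dist (Φ f₁) (Φ f₂) ≤ _ * dist (f₁ : C(Icc 0 τ', X)) f₂
    refine (ContinuousMap.dist_le (by positivity)).2 fun t => ?_
    rcases le_total (t : ℝ) τ with ht | ht
    · rw [hΦl f₁ f₁.2 t ht, hΦl f₂ f₂.2 t ht, dist_self]; positivity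
    have htt : (t : ℝ) ∈ Icc τ τ' := ⟨ht, t.2.2⟩
    rw [dist_eq_norm]
    change ‖g t + volterraConv K _ t - (g t + volterraConv K _ t)‖ ≤ _
    rw [add_sub_add_left_eq_sub]
    refine (hK.norm_volterraConv_sub_le (M := L * dist (f₁ : C(Icc 0 τ', X)) f₂) hτ.1 ht
      (t.2.2.trans hτ'T) (hFe f₁).continuousOn (hFe f₂).continuousOn
      (fun s hs => by rw [hSl f₁ f₁.2 s hs, hSl f₂ f₂.2 s hs]) fun s hs => ?_).trans
      ((hstep _ dist_nonneg t htt).trans (le_of_eq (by norm_num)))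
    rw [← dist_eq_norm]
    exact (hLip.dist_le_mul _ (hrU (hSr f₁ f₁.2 t htt s hs)) _ (hrU (hSr f₂ f₂.2 t htt s hs))).trans
      (mul_le_mul_of_nonneg_left (ContinuousMap.dist_apply_le_dist _) L.2)
  have hstart : (⟨fun t => w₀ t, by fun_prop⟩ : C(Icc 0 τ', X)) ∈ S := fun t =>
    ⟨fun _ => rfl, fun ht => by
      change w₀ t ∈ _
      rw [hw₀r t ht]; exact Metric.mem_closedBall_self hr.le⟩
  obtain ⟨f, -, hfix, -⟩ := hcontr.exists_fixedPoint' hSc hmaps hstart (edist_ne_top _ _)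
  refine ⟨τ', ⟨hττ', hτ'T⟩, IccExtend hτ'0 f, f.continuous.Icc_extend'.continuousOn,
    fun t ht => ?_⟩
  have h1 : Φ f ⟨t, ht⟩ = f ⟨t, ht⟩ := by rw [hfix]
  rw [IccExtend_of_mem _ _ ht]
  exact h1.symm

/-- If all solutions on subintervals of `[0, T]` satisfy a common bound on `F(w)`, then there is a
solution on `[0, T]`: at the supremum of the existence times the solutions fit together, and the
convolution of `K` with the bounded function `F(w)` is continuous up to that time. -/
theorem exists_isVolterraSolution_of_bounded (hK : IsSingularKernel K C a T)
    (hF : LocallyLipschitz F) (hg : ContinuousOn g (Icc 0 T)) (hT : 0 ≤ T) {R : ℝ}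
    (hR : ∀ τ ≤ T, ∀ w, IsVolterraSolution K F g τ w → ∀ t ∈ Icc 0 τ, ‖F (w t)‖ ≤ R) :
    ∃ w, IsVolterraSolution K F g T w := by
  set E : Set ℝ := {τ | τ ∈ Icc 0 T ∧ ∃ w, IsVolterraSolution K F g τ w} with hE
  have h0E : (0 : ℝ) ∈ E := ⟨⟨le_rfl, hT⟩, _, isVolterraSolution_zero g⟩
  have hbdd : BddAbove E := ⟨T, fun τ hτ => hτ.1.2⟩
  set σ := sSup E with hσ
  have hσ0 : 0 ≤ σ := le_csSup hbdd h0E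
  have hσT : σ ≤ T := csSup_le ⟨0, h0E⟩ fun τ hτ => hτ.1.2
  have hex : ∀ t : ℝ, ∃ w, t ∈ Ico 0 σ → IsVolterraSolution K F g t w := by
    intro t
    by_cases ht : t ∈ Ico 0 σ
    · obtain ⟨τ, hτ, htτ⟩ := exists_lt_of_lt_csSup ⟨0, h0E⟩ ht.2
      obtain ⟨w, hw⟩ := hτ.2
      exact ⟨w, fun _ => hw.mono htτ.le⟩
    · exact ⟨0, fun h => absurd h ht⟩
  choose sol hsol using hex
  set w : ℝ → X := fun t => sol t t with hw
  have hwsol : ∀ t ∈ Ico 0 σ, ∀ s ∈ Icc 0 t, w s = sol t s := fun t ht s hs =>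
    ((hsol t ht).mono hs.2).unique (hK.mono ((hs.2.trans ht.2.le).trans hσT)) hF
      (hsol s ⟨hs.1, hs.2.trans_lt ht.2⟩) s ⟨hs.1, le_rfl⟩
  have hws : ∀ t ∈ Ico 0 σ, IsVolterraSolution K F g t w := fun t ht =>
    (hsol t ht).congr (hwsol t ht)
  have hwc : ContinuousOn w (Ico 0 σ) := by
    intro t ht
    obtain ⟨t', htt', ht'σ⟩ := exists_between ht.2
    refine ((hws t' ⟨ht.1.trans htt'.le, ht'σ⟩).continuousOn t
      ⟨ht.1, htt'.le⟩).mono_of_mem_nhdsWithin ?_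
    filter_upwards [self_mem_nhdsWithin, nhdsWithin_le_nhds (Iio_mem_nhds htt')] with s hs hs'
    exact ⟨hs.1, le_of_lt hs'⟩
  -- the continuation of `w` to the closed interval `[0, σ]`
  set z : ℝ → X := fun t => g t + volterraConv K (fun s => F (w s)) t with hz
  have hzw : ∀ t ∈ Ico 0 σ, z t = w t := fun t ht =>
    ((hws t ht).eq t ⟨ht.1, le_rfl⟩).symm
  have hσE : IsVolterraSolution K F g σ z := by
    refine ⟨(hg.mono (Icc_subset_Icc_right hσT)).add
      ((hK.mono hσT).continuousOn_volterraConv (M := R) ?_ fun s hs => ?_), fun t ht => ?_⟩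
    · rw [← restrict_Ioo_eq_restrict_Ioc]
      exact (hF.continuous.comp_continuousOn (hwc.mono Ioo_subset_Ico_self)).aestronglyMeasurable
        measurableSet_Ioo
    · exact hR s (hs.2.le.trans hσT) w (hws s ⟨hs.1.le, hs.2⟩) s ⟨hs.1.le, le_rfl⟩
    · rw [hz]
      simp only
      congr 1
      exact volterraConv_congr ht.1 fun s hs => by
        rw [← hzw s ⟨hs.1.le, hs.2.trans_le ht.2⟩]
  rcases hσT.eq_or_lt with h | h
  · rw [← h]; exact ⟨z, hσE⟩
  · obtain ⟨τ', hτ', w', hw'⟩ := hσE.exists_extension hK hF hg ⟨hσ0, h⟩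
    exact absurd (le_csSup hbdd (show τ' ∈ E from ⟨⟨hσ0.trans hτ'.1.le, hτ'.2⟩, w', hw'⟩))
      (not_le.2 hτ'.1)

/-- Continuous dependence of a Volterra equation on its data, along a filter: if `F` is locally
Lipschitz, `Fn n → F` locally uniformly and `gn n → g` uniformly on `[0, T]`, then the perturbed
equations eventually have solutions on every interval `[0, T]` on which the limiting equation has
one, and these converge uniformly. -/
theorem IsVolterraSolution.continuous_dependence {ι : Type*} {l : Filter ι}
    (hK : IsSingularKernel K C a T) (hT : 0 ≤ T) {u : ℝ → X} (hu : IsVolterraSolution K F g T u)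
    (hF : LocallyLipschitz F) {Fn : ι → X → Y} (hFn : ∀ᶠ n in l, LocallyLipschitz (Fn n))
    (hconv : ∀ x, ∃ U ∈ 𝓝 x, TendstoUniformlyOn Fn F l U)
    {gn : ι → ℝ → X} (hgn : ∀ᶠ n in l, ContinuousOn (gn n) (Icc 0 T))
    (hgconv : TendstoUniformlyOn gn g l (Icc 0 T)) :
    (∀ᶠ n in l, ∃ w, IsVolterraSolution K (Fn n) (gn n) T w) ∧
      ∀ un : ι → ℝ → X, (∀ᶠ n in l, IsVolterraSolution K (Fn n) (gn n) T (un n)) →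
        TendstoUniformlyOn un u l (Icc 0 T) := by
  have hcpt : IsCompact (u '' Icc 0 T) := isCompact_Icc.image_of_continuousOn hu.continuousOn
  obtain ⟨ρ₁, hρ₁, L, hL, hLip⟩ := hF.exists_lipschitz_tube hcpt
  obtain ⟨ρ₂, hρ₂, hFconv⟩ := exists_tendsto_tube hconv hcpt
  set ρ := min ρ₁ ρ₂ with hρ
  have hρ0 : 0 < ρ := lt_min hρ₁ hρ₂
  have hLip' : ∀ s ∈ Icc 0 T, ∀ x, ‖x - u s‖ ≤ ρ → ‖F x - F (u s)‖ ≤ L * ‖x - u s‖ :=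
    fun s hs x hx => hLip (u s) (mem_image_of_mem u hs) x (hx.trans (min_le_left _ _))
  obtain ⟨M, hM, hstab⟩ := hu.stability hK hF.continuous hL hLip'
  have hclose : ∀ η > 0, M * η < ρ → ∀ᶠ n in l, ∀ τ ≤ T, ∀ w,
      IsVolterraSolution K (Fn n) (gn n) τ w → ∀ t ∈ Icc 0 τ, ‖w t - u t‖ ≤ M * η := by
    intro η hη hMη
    filter_upwards [hFconv η hη, hFn, Metric.tendstoUniformlyOn_iff.1 hgconv η hη]
      with n h1 h2 h3
    refine hstab η hη.le hMη (Fn n) (gn n) h2.continuous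
      (fun s hs x hx => h1 (u s) (mem_image_of_mem u hs) x (hx.trans (min_le_right _ _)))
      fun t ht => ?_
    have := h3 t ht
    rw [dist_comm, dist_eq_norm] at this
    exact this.le
  constructor
  · obtain ⟨R, hR⟩ := isCompact_Icc.exists_bound_of_continuousOn
      (hF.continuous.comp_continuousOn hu.continuousOn)
    have hη : M * (ρ / (2 * M)) < ρ := by
      rw [show M * (ρ / (2 * M)) = ρ / 2 by field_simp]; linarith
    filter_upwards [hclose _ (by positivity) hη, hFconv 1 one_pos, hFn, hgn] with n h1 h2 h3 h4
    refine exists_isVolterraSolution_of_bounded (R := 1 + (L * ρ + R)) hK h3 h4 hT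
      fun τ hτ w hw t ht => ?_
    have htT : t ∈ Icc 0 T := ⟨ht.1, ht.2.trans hτ⟩
    have hd := (h1 τ hτ w hw t ht).trans hη.le
    have e1 := h2 (u t) (mem_image_of_mem u htT) (w t) (hd.trans (min_le_right _ _))
    have e2 := (hLip' t htT (w t) hd).trans (mul_le_mul_of_nonneg_left hd hL)
    have e3 : ‖F (u t)‖ ≤ R := hR t htT
    calc ‖Fn n (w t)‖ = ‖(Fn n (w t) - F (w t)) + ((F (w t) - F (u t)) + F (u t))‖ := by
          congr 1; abel
      _ ≤ _ := (norm_add_le _ _).trans (add_le_add e1 ((norm_add_le _ _).trans (add_le_add e2 e3)))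
  · intro un hun
    refine Metric.tendstoUniformlyOn_iff.2 fun e he => ?_
    set m := min e ρ with hm
    have hm0 : 0 < m := lt_min he hρ0
    have hη : M * (m / (2 * M)) < m := by
      rw [show M * (m / (2 * M)) = m / 2 by field_simp]; linarith
    filter_upwards [hclose _ (by positivity) (hη.trans_le (min_le_right _ _)), hun]
      with n h1 h2 t ht
    rw [dist_comm, dist_eq_norm]
    exact ((h1 T le_rfl _ h2 t ht).trans_lt hη).trans_le (min_le_left _ _)

end VolterraExistence

/-! ### Bounds for the functional calculus -/

namespace Complexify

variable {H : Type*} [NormedAddCommGroup H] [InnerProductSpace ℝ H]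

lemma norm_map_le (T : H →L[ℝ] H) : ‖map T‖ ≤ ‖T‖ :=
  LinearMap.mkContinuous_norm_le _ (norm_nonneg _) _

lemma norm_compress_le (T : Complexify H →L[ℂ] Complexify H) : ‖compress T‖ ≤ ‖T‖ :=
  LinearMap.mkContinuous_norm_le _ (norm_nonneg T) _

lemma compress_sub (S T : Complexify H →L[ℂ] Complexify H) :
    compress (S - T) = compress S - compress T := rfl

end Complexify

namespace PosSelfAdjoint

variable {H : Type*} [NormedAddCommGroup H] [InnerProductSpace ℝ H] [CompleteSpace H]
variable (A : PosSelfAdjoint H)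

lemma norm_resolvent_le : ‖A.resolvent‖ ≤ 1 :=
  LinearMap.mkContinuous_norm_le _ zero_le_one _

lemma spectrum_resolvent_subset : spectrum ℝ (Complexify.map A.resolvent) ⊆ Icc 0 1 := by
  intro r hr
  refine ⟨spectrum_nonneg_of_nonneg A.map_resolvent_nonneg hr, ?_⟩
  have h1 := spectrum.norm_le_norm_mul_of_mem hr
  have h2 : ‖(1 : Complexify H →L[ℂ] Complexify H)‖ ≤ 1 := ContinuousLinearMap.norm_id_le
  have h3 := (Complexify.norm_map_le A.resolvent).trans A.norm_resolvent_le
  exact (le_abs_self r).trans (h1.trans (mul_le_one₀ h3 (norm_nonneg _) h2))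

/-- The functions `f` on `[0, ∞)` to which the functional calculus applies: those that are
continuous with a limit at `∞`. -/
structure IsSymbol (f : ℝ → ℝ) : Prop where
  continuousOn : ContinuousOn f (Ici 0)
  exists_tendsto : ∃ b, Tendsto f atTop (𝓝 b)

/-- The function `r ↦ f (1 / r - 1)` on `[0, 1]`, through which `f(A)` is defined as a function of
the resolvent `(1 + A)⁻¹`. -/
noncomputable def symbol (f : ℝ → ℝ) (r : ℝ) : ℝ :=
  if 0 < r then f (1 / r - 1) else limUnder atTop f

lemma fc_eq (f : ℝ → ℝ) :
    A.fc f = Complexify.compress (cfc (symbol f) (Complexify.map A.resolvent)) := rfl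

lemma one_div_sub_one_nonneg {r : ℝ} (h0 : 0 < r) (h1 : r ≤ 1) : 0 ≤ 1 / r - 1 := by
  rw [sub_nonneg, le_div_iff₀ h0]; linarith

lemma symbol_of_nonpos {f : ℝ → ℝ} {b r : ℝ} (hf : Tendsto f atTop (𝓝 b)) (hr : ¬ 0 < r) :
    symbol f r = b := by
  rw [symbol, if_neg hr, hf.limUnder_eq]

lemma symbol_of_pos {f : ℝ → ℝ} {r : ℝ} (hr : 0 < r) : symbol f r = f (1 / r - 1) := if_pos hr

lemma IsSymbol.continuousOn_symbol {f : ℝ → ℝ} (hf : IsSymbol f) :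
    ContinuousOn (symbol f) (Icc 0 1) := by
  obtain ⟨b, hb⟩ := hf.exists_tendsto
  intro r hr
  rcases hr.1.eq_or_lt with rfl | h
  · have hlim : Tendsto (fun r : ℝ => 1 / r - 1) (𝓝[>] 0) atTop := by
      simp only [one_div, sub_eq_add_neg]
      exact tendsto_atTop_add_const_right _ _ tendsto_inv_nhdsGT_zero
    have h1 : Tendsto (symbol f) (𝓝[>] 0) (𝓝 b) :=
      (hb.comp hlim).congr' (by
        filter_upwards [self_mem_nhdsWithin] with s hs
        exact (symbol_of_pos hs).symm)
    have h0 : symbol f 0 = b := symbol_of_nonpos hb (lt_irrefl 0)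
    have h2 : ContinuousWithinAt (symbol f) (Ioi 0) 0 := by
      rw [ContinuousWithinAt, h0]; exact h1
    exact (continuousWithinAt_Ioi_iff_Ici.1 h2).mono fun s hs => hs.1
  · have hc : ContinuousOn (fun s : ℝ => f (1 / s - 1)) (Ioc 0 1) :=
      hf.continuousOn.comp
        ((continuousOn_const.div continuousOn_id fun s hs => hs.1.ne').sub continuousOn_const)
        fun s hs => one_div_sub_one_nonneg hs.1 hs.2
    have h1 : ContinuousWithinAt (symbol f) (Ioc 0 1) r :=
      (hc r ⟨h, hr.2⟩).congr (fun s hs => symbol_of_pos hs.1) (symbol_of_pos h)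
    refine h1.mono_of_mem_nhdsWithin ?_
    filter_upwards [self_mem_nhdsWithin, nhdsWithin_le_nhds (Ioi_mem_nhds h)] with s hs hs'
    exact ⟨hs', hs.2⟩

lemma norm_fc_le {f : ℝ → ℝ} (hf : ∃ b, Tendsto f atTop (𝓝 b)) {M : ℝ}
    (hM : ∀ x, 0 ≤ x → |f x| ≤ M) : ‖A.fc f‖ ≤ M := by
  have hM0 : 0 ≤ M := (abs_nonneg _).trans (hM 0 le_rfl)
  obtain ⟨b, hb⟩ := hf
  rw [fc_eq]
  refine (Complexify.norm_compress_le _).trans (norm_cfc_le hM0 fun r hr => ?_)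
  have hr' := A.spectrum_resolvent_subset hr
  by_cases h : 0 < r
  · rw [symbol_of_pos h]
    exact hM _ (one_div_sub_one_nonneg h hr'.2)
  · rw [symbol_of_nonpos hb h]
    exact le_of_tendsto hb.abs ((eventually_ge_atTop 0).mono hM)

lemma IsSymbol.sub {f₁ f₂ : ℝ → ℝ} (h₁ : IsSymbol f₁) (h₂ : IsSymbol f₂) :
    IsSymbol (fun x => f₁ x - f₂ x) := by
  obtain ⟨b₁, hb₁⟩ := h₁.exists_tendsto
  obtain ⟨b₂, hb₂⟩ := h₂.exists_tendsto
  exact ⟨h₁.continuousOn.sub h₂.continuousOn, _, hb₁.sub hb₂⟩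

lemma fc_sub {f₁ f₂ : ℝ → ℝ} (h₁ : IsSymbol f₁) (h₂ : IsSymbol f₂) :
    A.fc (fun x => f₁ x - f₂ x) = A.fc f₁ - A.fc f₂ := by
  obtain ⟨b₁, hb₁⟩ := h₁.exists_tendsto
  obtain ⟨b₂, hb₂⟩ := h₂.exists_tendsto
  have : symbol (fun x => f₁ x - f₂ x) = fun r => symbol f₁ r - symbol f₂ r := by
    funext r
    by_cases h : 0 < r
    · simp only [symbol_of_pos h]
    · rw [symbol_of_nonpos hb₁ h, symbol_of_nonpos hb₂ h, symbol_of_nonpos (hb₁.sub hb₂) h]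
  rw [fc_eq, fc_eq, fc_eq, this, cfc_sub _ _ _
    (h₁.continuousOn_symbol.mono A.spectrum_resolvent_subset)
    (h₂.continuousOn_symbol.mono A.spectrum_resolvent_subset), Complexify.compress_sub]

lemma norm_fc_sub_fc_le {f₁ f₂ : ℝ → ℝ} (h₁ : IsSymbol f₁) (h₂ : IsSymbol f₂) {M : ℝ}
    (hM : ∀ x, 0 ≤ x → |f₁ x - f₂ x| ≤ M) : ‖A.fc f₁ - A.fc f₂‖ ≤ M := by
  rw [← A.fc_sub h₁ h₂]
  exact A.norm_fc_le (h₁.sub h₂).exists_tendsto hM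

/-- `f(A) (1 + A)⁻¹ = h(A)` with `h(l) = f(l) / (1 + l)`. The compression to the real space is
multiplicative here, as the complexified resolvent preserves the real subspace. -/
lemma fc_apply_resolvent {f : ℝ → ℝ} (hf : IsSymbol f) (y : H) :
    A.fc f (A.resolvent y) = A.fc (fun l => f l * (1 + l)⁻¹) y := by
  obtain ⟨b, hb⟩ := hf.exists_tendsto
  have hsa : IsSelfAdjoint (Complexify.map A.resolvent) := .of_nonneg A.map_resolvent_nonneg
  have hinv : Tendsto (fun l : ℝ => (1 + l)⁻¹) atTop (𝓝 0) :=
    tendsto_inv_atTop_zero.comp (tendsto_atTop_add_const_left _ _ tendsto_id)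
  have hsym : (spectrum ℝ (Complexify.map A.resolvent)).EqOn
      (symbol fun l => f l * (1 + l)⁻¹) (fun r => symbol f r * id r) := by
    intro r hr
    have hr0 := (A.spectrum_resolvent_subset hr).1
    rcases hr0.eq_or_lt with rfl | h
    · rw [symbol_of_nonpos (hb.mul hinv) (lt_irrefl 0)]; simp
    · simp only [symbol_of_pos h, id]
      congr 1
      rw [add_sub_cancel, one_div, inv_inv]
  rw [fc_eq, fc_eq, cfc_congr hsym, cfc_mul _ _ _
    (hf.continuousOn_symbol.mono A.spectrum_resolvent_subset) continuousOn_id,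
    cfc_id ℝ (Complexify.map A.resolvent) hsa]
  have : Complexify.map A.resolvent (Complexify.mk y 0) = Complexify.mk (A.resolvent y) 0 :=
    Complexify.ext' rfl (map_zero _)
  change Complexify.re _ = Complexify.re _
  rw [mul_apply_eq_comp, this]

lemma dense_range_resolvent : DenseRange A.resolvent := by
  refine A.isSelfAdjoint.dense_domain.mono fun x hx => ?_
  have := A.range_toBase_one
  rw [toBase, fc_inv] at this
  rw [← this] at hx
  obtain ⟨c, rfl⟩ := hx
  exact ⟨_, rfl⟩

/-! ### The analytic semigroup -/

/-- The function `l ↦ (1 + l) ^ p * e^(-t l)`, which gives the semigroup between two spaces of the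
scale. -/
noncomputable def heatSymbol (p t l : ℝ) : ℝ := (1 + l) ^ p * Real.exp (-(t * l))

lemma heatSymbol_zero_left (t l : ℝ) : heatSymbol 0 t l = Real.exp (-(t * l)) := by
  rw [heatSymbol, Real.rpow_zero, one_mul]

lemma continuousOn_heatSymbol (p t : ℝ) : ContinuousOn (heatSymbol p t) (Ici 0) := by
  refine ContinuousOn.mul (ContinuousOn.rpow_const (by fun_prop) fun l hl => Or.inl ?_)
    (by fun_prop)
  have : (0 : ℝ) ≤ l := hl
  positivity

lemma isSymbol_heatSymbol (p : ℝ) {t : ℝ} (ht : 0 < t) : IsSymbol (heatSymbol p t) := by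
  refine ⟨continuousOn_heatSymbol p t, 0, ?_⟩
  have h1 := (tendsto_rpow_mul_exp_neg_mul_atTop_nhds_zero p t ht).comp
    (tendsto_atTop_add_const_left atTop (1 : ℝ) tendsto_id)
  have h2 := h1.mul_const (Real.exp t)
  rw [zero_mul] at h2
  refine h2.congr fun l => ?_
  simp only [Function.comp, id, heatSymbol]
  rw [mul_assoc, ← Real.exp_add]; congr 2; ring

lemma isSymbol_exp {t : ℝ} (ht : 0 ≤ t) : IsSymbol (heatSymbol 0 t) := by
  rcases ht.eq_or_lt with rfl | h
  · exact ⟨continuousOn_heatSymbol 0 0, 1,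
      tendsto_const_nhds.congr fun l => by simp [heatSymbol]⟩
  · exact isSymbol_heatSymbol 0 h

/-- The smoothing estimate `(1 + l) ^ a e^(-t l) ≤ e^t t ^ (-a)`. -/
lemma abs_heatSymbol_le {a t l : ℝ} (ha0 : 0 ≤ a) (ha1 : a ≤ 1) (ht : 0 < t) (hl : 0 ≤ l) :
    |heatSymbol a t l| ≤ Real.exp t * t ^ (-a) := by
  have hx : 0 < 1 + l := by linarith
  rw [heatSymbol, abs_of_nonneg (by positivity)]
  have h1 : (t * (1 + l)) ^ a ≤ Real.exp (t * (1 + l)) := by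
    have hy : 0 < t * (1 + l) := by positivity
    calc (t * (1 + l)) ^ a ≤ Real.exp (t * (1 + l)) ^ a :=
          Real.rpow_le_rpow hy.le (by linarith [Real.add_one_le_exp (t * (1 + l))]) ha0
      _ = Real.exp (t * (1 + l) * a) := (Real.exp_mul _ _).symm
      _ ≤ _ := Real.exp_le_exp.2 (by nlinarith)
  rw [Real.mul_rpow ht.le hx.le] at h1
  rw [Real.rpow_neg ht.le, ← div_eq_mul_inv, le_div_iff₀ (by positivity)]
  calc (1 + l) ^ a * Real.exp (-(t * l)) * t ^ a
      = t ^ a * (1 + l) ^ a * Real.exp (-(t * l)) := by ring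
    _ ≤ Real.exp (t * (1 + l)) * Real.exp (-(t * l)) := by gcongr
    _ = Real.exp t := by rw [← Real.exp_add]; congr 1; ring

lemma abs_exp_neg_sub_exp_neg_le {m s t l : ℝ} (hs : m ≤ s) (ht : m ≤ t) (hl : 0 ≤ l) :
    |Real.exp (-(t * l)) - Real.exp (-(s * l))| ≤ |t - s| * l * Real.exp (-(m * l)) := by
  wlog hst : s ≤ t generalizing s t
  · rw [abs_sub_comm, abs_sub_comm t]
    exact this ht hs (le_of_not_ge hst)
  have h1 : Real.exp (-(t * l)) = Real.exp (-(s * l)) * Real.exp (-((t - s) * l)) := by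
    rw [← Real.exp_add]; congr 1; ring
  have h2 : Real.exp (-((t - s) * l)) ≤ 1 :=
    Real.exp_le_one_iff.2 (neg_nonpos.2 (mul_nonneg (sub_nonneg.2 hst) hl))
  have h3 : Real.exp (-(s * l)) ≤ Real.exp (-(m * l)) :=
    Real.exp_le_exp.2 (neg_le_neg (mul_le_mul_of_nonneg_right hs hl))
  have h4 := Real.add_one_le_exp (-((t - s) * l))
  have h5 : 0 ≤ (t - s) * l := mul_nonneg (sub_nonneg.2 hst) hl
  rw [abs_of_nonneg (sub_nonneg.2 hst), h1, abs_of_nonpos (by nlinarith [Real.exp_pos (-(s * l))])]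
  calc -(Real.exp (-(s * l)) * Real.exp (-((t - s) * l)) - Real.exp (-(s * l)))
      = (1 - Real.exp (-((t - s) * l))) * Real.exp (-(s * l)) := by ring
    _ ≤ ((t - s) * l) * Real.exp (-(m * l)) :=
        mul_le_mul (by linarith) h3 (Real.exp_pos _).le h5

lemma abs_heatSymbol_sub_le {a m s t l : ℝ} (ha1 : a ≤ 1) (hm : 0 < m) (hs : m ≤ s) (ht : m ≤ t)
    (hl : 0 ≤ l) :
    |heatSymbol a t l - heatSymbol a s l| ≤ 2 * Real.exp m / m ^ 2 * |t - s| := by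
  have hx : 1 ≤ 1 + l := by linarith
  have h1 : (1 + l) ^ a ≤ 1 + l := by
    simpa using Real.rpow_le_rpow_of_exponent_le hx ha1
  have h2 : (1 + l) ^ 2 * Real.exp (-(m * l)) ≤ 2 * Real.exp m / m ^ 2 := by
    have h3 : (m * (1 + l)) ^ 2 / 2 ≤ Real.exp (m * (1 + l)) := by
      have := Real.quadratic_le_exp_of_nonneg (x := m * (1 + l)) (by positivity)
      have : 0 ≤ m * (1 + l) := by positivity
      linarith
    rw [le_div_iff₀ (by positivity)]
    calc (1 + l) ^ 2 * Real.exp (-(m * l)) * m ^ 2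
        = 2 * ((m * (1 + l)) ^ 2 / 2 * Real.exp (-(m * l))) := by ring
      _ ≤ 2 * (Real.exp (m * (1 + l)) * Real.exp (-(m * l))) := by gcongr
      _ = 2 * Real.exp m := by rw [← Real.exp_add]; congr 2; ring
  rw [heatSymbol, heatSymbol, ← mul_sub, abs_mul, abs_of_nonneg (by positivity)]
  calc (1 + l) ^ a * |Real.exp (-(t * l)) - Real.exp (-(s * l))|
      ≤ (1 + l) * (|t - s| * l * Real.exp (-(m * l))) :=
        mul_le_mul h1 (abs_exp_neg_sub_exp_neg_le hs ht hl) (abs_nonneg _) (by linarith)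
    _ = |t - s| * (((1 + l) * l) * Real.exp (-(m * l))) := by ring
    _ ≤ |t - s| * ((1 + l) ^ 2 * Real.exp (-(m * l))) := by
        gcongr
        nlinarith
    _ ≤ |t - s| * (2 * Real.exp m / m ^ 2) := by gcongr
    _ = _ := mul_comm _ _

/-- The semigroup between two spaces of the scale in terms of the recording vectors. -/
lemma semigroup_eq (β α t : ℝ) :
    A.semigroup β α t = ((A.lift α).symm : H →L[ℝ] A.Hs α) ∘L
      (A.fc (heatSymbol (α - β) t)) ∘L (A.lift β : A.Hs β →L[ℝ] H) := rfl

lemma norm_semigroup_le {β α t M : ℝ} (h : ‖A.fc (heatSymbol (α - β) t)‖ ≤ M) :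
    ‖A.semigroup β α t‖ ≤ M :=
  h

lemma norm_semigroup_sub_le {β α s t M : ℝ}
    (h : ‖A.fc (heatSymbol (α - β) t) - A.fc (heatSymbol (α - β) s)‖ ≤ M) :
    ‖A.semigroup β α t - A.semigroup β α s‖ ≤ M :=
  h

/-- `t ↦ e^(-tA)` is a weakly singular kernel from `H^(γ - a)` to `H^γ`. -/
theorem isSingularKernel_semigroup {γ a : ℝ} (ha : a ∈ Ico (0 : ℝ) 1) (T : ℝ) :
    IsSingularKernel (A.semigroup (γ - a) γ) (Real.exp T) a T := by
  refine ⟨fun t₀ ht₀ => ContinuousAt.continuousWithinAt ?_, (Real.exp_pos _).le, ha.1, ha.2,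
    fun t ht => ?_⟩
  · have hm : 0 < t₀ / 2 := half_pos ht₀
    rw [ContinuousAt, tendsto_iff_norm_sub_tendsto_zero]
    have hlim : Tendsto (fun t => 2 * Real.exp (t₀ / 2) / (t₀ / 2) ^ 2 * |t - t₀|) (𝓝 t₀)
        (𝓝 0) := by
      have : ContinuousAt (fun t => 2 * Real.exp (t₀ / 2) / (t₀ / 2) ^ 2 * |t - t₀|) t₀ := by
        fun_prop
      simpa [ContinuousAt] using this
    refine squeeze_zero' (Eventually.of_forall fun t => norm_nonneg _) ?_ hlim
    filter_upwards [Ioi_mem_nhds (show t₀ / 2 < t₀ from half_lt_self ht₀)] with t ht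
    refine A.norm_semigroup_sub_le ?_
    rw [sub_sub_cancel]
    exact A.norm_fc_sub_fc_le (isSymbol_heatSymbol a (hm.trans ht)) (isSymbol_heatSymbol a ht₀)
      fun l hl => abs_heatSymbol_sub_le ha.2.le hm (half_lt_self ht₀).le (le_of_lt ht) hl
  · refine A.norm_semigroup_le ?_
    rw [sub_sub_cancel]
    refine A.norm_fc_le (isSymbol_heatSymbol a ht.1).exists_tendsto fun l hl =>
      (abs_heatSymbol_le ha.1 ha.2.le ht.1 hl).trans ?_
    gcongr
    · exact Real.rpow_nonneg ht.1.le _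
    · exact ht.2

lemma norm_semigroup_self_le (γ : ℝ) {t : ℝ} (ht : 0 ≤ t) : ‖A.semigroup γ γ t‖ ≤ 1 := by
  refine A.norm_semigroup_le ?_
  rw [sub_self]
  refine A.norm_fc_le (isSymbol_exp ht).exists_tendsto fun l hl => ?_
  rw [heatSymbol_zero_left, abs_of_nonneg (Real.exp_pos _).le]
  exact Real.exp_le_one_iff.2 (neg_nonpos.2 (mul_nonneg ht hl))

/-- Strong continuity of `e^(-tA)`: on the dense range of the resolvent the semigroup is Lipschitz
in time, and it is a contraction. -/
lemma continuousOn_fc_exp (x : H) : ContinuousOn (fun t => A.fc (heatSymbol 0 t) x) (Ici 0) := by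
  refine continuousOn_of_uniform_approx_of_continuousOn fun u hu => ?_
  obtain ⟨e, he, heu⟩ := Metric.mem_uniformity_dist.1 hu
  obtain ⟨y, hy⟩ := A.dense_range_resolvent.exists_dist_lt x he
  refine ⟨fun t => A.fc (heatSymbol 0 t) (A.resolvent y), ?_, fun t ht => heu ?_⟩
  · refine LipschitzOnWith.continuousOn (K := ‖y‖₊) (LipschitzOnWith.of_dist_le_mul
      fun t ht s hs => ?_)
    have hdecay : ∀ t : ℝ, 0 ≤ t → IsSymbol fun l => heatSymbol 0 t l * (1 + l)⁻¹ := by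
      intro t ht
      obtain ⟨b, hb⟩ := (isSymbol_exp ht).exists_tendsto
      refine ⟨(continuousOn_heatSymbol 0 t).mul (ContinuousOn.inv₀ (by fun_prop) fun l hl => ?_), _,
        hb.mul (tendsto_inv_atTop_zero.comp (tendsto_atTop_add_const_left _ _ tendsto_id))⟩
      have : (0 : ℝ) ≤ l := hl
      positivity
    rw [A.fc_apply_resolvent (isSymbol_exp ht), A.fc_apply_resolvent (isSymbol_exp hs),
      dist_eq_norm, ← sub_apply, mul_comm, Real.dist_eq]
    refine ((A.fc _ - A.fc _).le_opNorm y).trans (mul_le_mul_of_nonneg_right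
      (A.norm_fc_sub_fc_le (hdecay t ht) (hdecay s hs) fun l hl => ?_) (norm_nonneg _))
    have h1 := abs_exp_neg_sub_exp_neg_le (m := 0) hs ht hl
    rw [zero_mul, neg_zero, Real.exp_zero, mul_one] at h1
    have hx : 0 < 1 + l := by linarith
    rw [heatSymbol_zero_left, heatSymbol_zero_left, ← sub_mul, abs_mul, abs_of_pos (inv_pos.2 hx),
      ← div_eq_mul_inv, div_le_iff₀ hx]
    nlinarith [abs_nonneg (t - s)]
  · have h1 : ‖A.fc (heatSymbol 0 t)‖ ≤ 1 := by
      have := A.norm_semigroup_self_le 0 ht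
      rw [semigroup_eq, sub_self] at this
      exact this
    rw [dist_eq_norm, ← map_sub]
    refine (ContinuousLinearMap.le_opNorm _ _).trans_lt (lt_of_le_of_lt ?_ hy)
    rw [dist_eq_norm]
    exact mul_le_of_le_one_left (norm_nonneg _) h1

lemma continuousOn_semigroup_self (γ : ℝ) (x : A.Hs γ) :
    ContinuousOn (fun t => A.semigroup γ γ t x) (Ici 0) := by
  have h := A.continuousOn_fc_exp (A.lift γ x)
  simp only [semigroup_eq, sub_self]
  exact (A.lift γ).symm.continuous.comp_continuousOn h

/-! ### Mild solutions -/

/-- A mild solution is a solution of the Volterra equation with kernel `e^(-tA)` and forcing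
`e^(-tA) u₀ + (v(t) - e^(-tA) v(0))`; the integrability in the definition of a mild solution is
automatic. -/
lemma isMildSolution_iff {γ a T : ℝ} (ha : a ∈ Ico (0 : ℝ) 1) {F : A.Hs γ → A.Hs (γ - a)}
    (hF : Continuous F) {v : ℝ → A.Hs γ} {u₀ : A.Hs γ} {u : ℝ → A.Hs γ} :
    A.IsMildSolution F v u₀ T u ↔ IsVolterraSolution (A.semigroup (γ - a) γ) F
      (fun t => A.semigroup γ γ t u₀ + (v t - A.semigroup γ γ t (v 0))) T u := by
  constructor
  · intro h
    exact ⟨h.continuousOn, fun t ht => (h.eq t ht).trans (add_right_comm _ _ _)⟩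
  · intro h
    refine ⟨h.continuousOn, fun t ht => ?_, fun t ht => (h.eq t ht).trans (add_right_comm _ _ _)⟩
    exact (A.isSingularKernel_semigroup ha T).intervalIntegrable_of_continuousOn ht
      (hF.comp_continuousOn (h.continuousOn.mono (Icc_subset_Icc_right ht.2)))

lemma continuousOn_forcing {γ : ℝ} {v : ℝ → A.Hs γ} (hv : ContinuousOn v (Ici 0)) (u₀ : A.Hs γ)
    (T : ℝ) :
    ContinuousOn (fun t => A.semigroup γ γ t u₀ + (v t - A.semigroup γ γ t (v 0))) (Icc 0 T) :=
  ((A.continuousOn_semigroup_self γ u₀).add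
    (hv.sub (A.continuousOn_semigroup_self γ (v 0)))).mono Icc_subset_Ici_self

end PosSelfAdjoint

/-! ### Convergence of mild solutions -/

theorem theorem1 {H Ω : Type*} [NormedAddCommGroup H] [InnerProductSpace ℝ H] [CompleteSpace H]
    [MeasurableSpace Ω] (μ : Measure Ω) [IsProbabilityMeasure μ]
    (A : PosSelfAdjoint H) (Q : H →L[ℝ] H)
    (W : ℝ≥0 → H → Ω → ℝ) (hW : IsCylindricalWiener W μ)
    (γ a : ℝ) (hγ : 0 ≤ γ) (ha : a ∈ Ico (0 : ℝ) 1)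
    (v : ℝ → Ω → A.Hs γ)
    (hv : IsLinearSolution A Q W μ (fun t ω => A.toBase γ (v t ω)))
    (hvγ : ∀ᵐ ω ∂μ, ContinuousOn (fun t => v t ω) (Ici 0))
    (F : A.Hs γ → A.Hs (γ - a)) (hF : LocallyLipschitz F)
    (Fε : ℝ → A.Hs γ → A.Hs (γ - a)) (hFε : ∀ ε, 0 < ε → LocallyLipschitz (Fε ε))
    (hconv : ∀ x, ∃ U ∈ 𝓝 x, TendstoUniformlyOn Fε F (𝓝[>] 0) U) :
    ∀ᵐ ω ∂μ, ∀ (u₀ : A.Hs γ) (u₀ε : ℝ → A.Hs γ), Tendsto u₀ε (𝓝[>] 0) (𝓝 u₀) →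
      (∃ T > 0, ∃ u, A.IsMildSolution F (fun t => v t ω) u₀ T u) ∧
      ∀ T > 0, ∀ u, A.IsMildSolution F (fun t => v t ω) u₀ T u →
        (∀ᶠ ε in 𝓝[>] 0, ∃ w, A.IsMildSolution (Fε ε) (fun t => v t ω) (u₀ε ε) T w) ∧
        ∀ uε : ℝ → ℝ → A.Hs γ,
          (∀ᶠ ε in 𝓝[>] 0, A.IsMildSolution (Fε ε) (fun t => v t ω) (u₀ε ε) T (uε ε)) →
          TendstoUniformlyOn uε u (𝓝[>] 0) (Icc 0 T) := by
  filter_upwards [hvγ] with ω hω u₀ u₀ε hu₀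
  have hcont := fun x T => A.continuousOn_forcing hω x T
  constructor
  · obtain ⟨T, hT, u, hu⟩ := (isVolterraSolution_zero _).exists_extension
      (A.isSingularKernel_semigroup ha 1) hF (hcont u₀ 1) ⟨le_rfl, one_pos⟩
    exact ⟨T, hT.1, u, (A.isMildSolution_iff ha hF.continuous).2 hu⟩
  intro T hT u hu
  have hg : TendstoUniformlyOn
      (fun ε t => A.semigroup γ γ t (u₀ε ε) + (v t ω - A.semigroup γ γ t (v 0 ω)))
      (fun t => A.semigroup γ γ t u₀ + (v t ω - A.semigroup γ γ t (v 0 ω))) (𝓝[>] 0)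
      (Icc 0 T) := by
    refine Metric.tendstoUniformlyOn_iff.2 fun e he => ?_
    filter_upwards [Metric.tendsto_nhds.1 hu₀ e he] with ε hε t ht
    rw [dist_comm] at hε
    rw [dist_add_right, dist_eq_norm, ← map_sub]
    refine ((A.semigroup γ γ t).le_opNorm _).trans_lt (lt_of_le_of_lt ?_ hε)
    rw [dist_eq_norm]
    exact mul_le_of_le_one_left (norm_nonneg _) (A.norm_semigroup_self_le γ ht.1)
  have hLip : ∀ᶠ ε in 𝓝[>] (0 : ℝ), LocallyLipschitz (Fε ε) := by
    filter_upwards [self_mem_nhdsWithin] with ε hε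
    exact hFε ε hε
  obtain ⟨hex, hlim⟩ := IsVolterraSolution.continuous_dependence
    (A.isSingularKernel_semigroup ha T) hT.le ((A.isMildSolution_iff ha hF.continuous).1 hu) hF
    hLip hconv (Eventually.of_forall fun ε => hcont (u₀ε ε) T) hg
  refine ⟨?_, fun uε huε => hlim uε ?_⟩
  · filter_upwards [hex, hLip] with ε hε hL
    obtain ⟨w, hw⟩ := hε
    exact ⟨w, (A.isMildSolution_iff ha hL.continuous).2 hw⟩
  · filter_upwards [huε, hLip] with ε hε hL
    exact (A.isMildSolution_iff ha hL.continuous).1 hε
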